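/- Let $f:\mathbb{R}^n\to\mathbb{R}$ be convex and $c_i:\mathbb{R}^n\to\mathbb{R}$, $i=1,\dots,m$, concave, all of class $C^2$. Let $\Omega=\{x: c_i(x)\ge 0,\ i=1,\dots,m\}$, let $x^*$ minimize $f$ on $\Omega$, and let $I^*=\{i: c_i(x^*)=0\}$. A *center* is a point $y\in\operatorname{int}\Omega$ with $f(y)>f(x^*)$. For a center $y$, $\lambda\in\mathbb{R}^m_+$ and $k>0$ put $$L_y(x,\lambda)=-\ln(f(y)-f(x))-\sum_{i=1}^m\lambda_i c_i(x),\qquad \mathcal{L}_y(x,\lambda,k)=-\ln(f(y)-f(x))-k^{-1}\sum_{i=1}^m\lambda_i\ln(kc_i(x)+1);$$ the exterior distance function (EDF) $\mathcal{L}_y(\cdot,\lambda,k)$ is considered on its domain $D_{y,k}=\{x: f(x)<f(y),\ kc_i(x)+1>0,\ i=1,\dots,m\}$. Assume the second-order sufficient optimality condition: for every center $y$ there is $\lambda^*=\lambda^*(y)\in\mathbb{R}^m$ with $\nabla_xL_y(x^*,\lambda^*)=0$, $\lambda^*_ic_i(x^*)=0$ for all $i$, and $\lambda_i^*>0$ for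 $i\in I^*$; there is $\mu=\mu(y)>0$ such that $(\nabla^2_{xx}L_y(x^*,\lambda^*)u,u)\ge\mu(u,u)$ for all $u$ with $(\nabla c_i(x^*),u)=0$, $i\in I^*$; and the gradients $\nabla c_i(x^*)$, $i\in I^*$, are linearly independent (the Jacobian of the active constraints has full row rank). For a center $y$, $\delta>0$ and $k_0>0$ let $\Lambda_y(\delta,k_0)$ be the set of pairs $(\lambda,k)$ such that $k\ge k_0$; $\lambda_i\ge\delta$ and $|\lambda_i-\lambda_i^*|\le\delta k$ for $i\in I^*$; and $0\le\lambda_i\le\delta k$ for $i\notin I^*$. Let $\|\cdot\|$ be the maximum norm. Then for every $M\in\mathbb{R}$ there are $\delta>0$ and $k_0>0$ such that for every center $y$ with $f(y)\le M$ one has $\delta<\lambda_i^*(y)$ for all $i\in I^*$, and there is $c>0$ (independent of $k$ and $\lambda$) such that for every $(\lambda,k)\in\Lambda_y(\delta,k_0)$: 1. The EDF $\mathcal{L}_y(\cdot,\lambda,k)$ has exactly one minimizer $\hat x=\hat x(\lambda,k)$ on $D_{y,k}$, and $\nabla_x\mathcal{L}_y(\hat x,\lambda,k)=0$. So the updated multipliers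 $\hat\lambda=\hat\lambda(\lambda,k)$ with $\hat\lambda_i=\lambda_i(kc_i(\hat x)+1)^{-1}$ are defined. 2. $\max\{\|\hat x-x^*\|,\|\hat\lambda-\lambda^*\|\}\le c\,k^{-1}\|\lambda-\lambda^*\|$. Moreover $\hat x(\lambda^*,k)=x^*$ and $\hat\lambda(\lambda^*,k)=\lambda^*$ for all $k\ge k_0$, that is, $\lambda^*$ is a fixed point of $\lambda\mapsto\hat\lambda(\lambda,k)$. 3. $\mathcal{L}_y(\cdot,\lambda,k)$ is strongly convex in a neighborhood of $\hat x$. -/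

import Mathlib

open scoped BigOperators

noncomputable section

namespace ExteriorDistance

/-- The feasible set `Ω = {x : c i x ≥ 0 for all i}`. -/
def feasibleSet {n m : ℕ} (c : Fin m → EuclideanSpace ℝ (Fin n) → ℝ) :
    Set (EuclideanSpace ℝ (Fin n)) :=
  {x | ∀ i, 0 ≤ c i x}

/-- The transformed objective `F(x,y) = -ln (f y - f x)`; it is meaningful where `f x < f y`. -/
def transformedObjective {n : ℕ} (f : EuclideanSpace ℝ (Fin n) → ℝ)
    (y x : EuclideanSpace ℝ (Fin n)) : ℝ :=
  -Real.log (f y - f x)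

/-- The Lagrangian `L_y(x,l) = F(x,y) - ∑ l i * c i x` of the problem
`min {F(x,y) : c i x ≥ 0}`. -/
def lagrangian {n m : ℕ} (f : EuclideanSpace ℝ (Fin n) → ℝ)
    (c : Fin m → EuclideanSpace ℝ (Fin n) → ℝ) (y : EuclideanSpace ℝ (Fin n))
    (l : Fin m → ℝ) (x : EuclideanSpace ℝ (Fin n)) : ℝ :=
  transformedObjective f y x - ∑ i, l i * c i x

/-- The exterior distance function
`F(x,y) - k⁻¹ ∑ l i * ln (k * c i x + 1)` with center `y`, multipliers `l` and scaling
parameter `k`. It is used only at points of `edfDomain`. -/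
def edf {n m : ℕ} (f : EuclideanSpace ℝ (Fin n) → ℝ)
    (c : Fin m → EuclideanSpace ℝ (Fin n) → ℝ) (y : EuclideanSpace ℝ (Fin n))
    (l : Fin m → ℝ) (k : ℝ) (x : EuclideanSpace ℝ (Fin n)) : ℝ :=
  transformedObjective f y x - k⁻¹ * ∑ i, l i * Real.log (k * c i x + 1)

/-- The set of points at which all the logarithms in the exterior distance function have a
positive argument. -/
def edfDomain {n m : ℕ} (f : EuclideanSpace ℝ (Fin n) → ℝ)
    (c : Fin m → EuclideanSpace ℝ (Fin n) → ℝ) (y : EuclideanSpace ℝ (Fin n)) (k : ℝ) :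
    Set (EuclideanSpace ℝ (Fin n)) :=
  {x | f x < f y ∧ ∀ i, 0 < k * c i x + 1}

/-- `x` minimizes the exterior distance function (which counts as `+∞` off its domain). -/
def IsEDFMinimizer {n m : ℕ} (f : EuclideanSpace ℝ (Fin n) → ℝ)
    (c : Fin m → EuclideanSpace ℝ (Fin n) → ℝ) (y : EuclideanSpace ℝ (Fin n))
    (l : Fin m → ℝ) (k : ℝ) (x : EuclideanSpace ℝ (Fin n)) : Prop :=
  x ∈ edfDomain f c y k ∧ IsMinOn (edf f c y l k) (edfDomain f c y k) x

/-- The multiplier update `l i ↦ l i / (k * c i x + 1)`. -/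
def multiplierUpdate {n m : ℕ} (c : Fin m → EuclideanSpace ℝ (Fin n) → ℝ)
    (l : Fin m → ℝ) (k : ℝ) (x : EuclideanSpace ℝ (Fin n)) : Fin m → ℝ :=
  fun i => l i * (k * c i x + 1)⁻¹

/-- The Hessian of `g` at `x`, as a linear map. -/
def hessian {n : ℕ} (g : EuclideanSpace ℝ (Fin n) → ℝ) (x : EuclideanSpace ℝ (Fin n)) :
    EuclideanSpace ℝ (Fin n) →L[ℝ] EuclideanSpace ℝ (Fin n) :=
  fderiv ℝ (gradient g) x

/-- The Jacobian at `x` of the constraints that are active at `x`; its rows are the gradients. -/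
def activeJacobian {n m : ℕ} (c : Fin m → EuclideanSpace ℝ (Fin n) → ℝ)
    (x : EuclideanSpace ℝ (Fin n)) : Matrix {i : Fin m // c i x = 0} (Fin n) ℝ :=
  Matrix.of fun i j => gradient (c i.1) x j

/-- The Karush-Kuhn-Tucker conditions for `min {F(x,y) : c i x ≥ 0}` at `(x,l)`, with positive
multipliers of the active constraints. -/
structure IsStrictKKT {n m : ℕ} (f : EuclideanSpace ℝ (Fin n) → ℝ)
    (c : Fin m → EuclideanSpace ℝ (Fin n) → ℝ) (y x : EuclideanSpace ℝ (Fin n))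
    (l : Fin m → ℝ) : Prop where
  feasible : x ∈ feasibleSet c
  stationary : gradient (lagrangian f c y l) x = 0
  complementary : ∀ i, l i * c i x = 0
  active_pos : ∀ i, c i x = 0 → 0 < l i

/-- The second order sufficient optimality condition for `min {F(x,y) : c i x ≥ 0}` at the
pair `(x,l)`: the Hessian of the Lagrangian is positive definite on the kernel of the active
Jacobian, and the active Jacobian has full row rank. -/
structure SecondOrderSufficient {n m : ℕ} (f : EuclideanSpace ℝ (Fin n) → ℝ)
    (c : Fin m → EuclideanSpace ℝ (Fin n) → ℝ) (y x : EuclideanSpace ℝ (Fin n))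
    (l : Fin m → ℝ) : Prop where
  kkt : IsStrictKKT f c y x l
  curvature : ∃ μ : ℝ, 0 < μ ∧ ∀ u : EuclideanSpace ℝ (Fin n),
    (activeJacobian c x).mulVec u.ofLp = 0 →
      μ * inner ℝ u u ≤ inner ℝ (hessian (lagrangian f c y l) x u) u
  full_rank : (activeJacobian c x).rank = Nat.card {i : Fin m // c i x = 0}

/-- The extended dual neighborhood of the multiplier vector `ls` that belongs to the solution
`xs`: the pairs `(l,k)` with `k ≥ k₀`, with `l i ≥ δ` and `|l i - ls i| ≤ δ k` for the
constraints active at `xs`, and with `0 ≤ l i ≤ δ k` for the passive ones. -/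
def dualNeighborhood {n m : ℕ} (c : Fin m → EuclideanSpace ℝ (Fin n) → ℝ)
    (xs : EuclideanSpace ℝ (Fin n)) (ls : Fin m → ℝ) (δ k₀ : ℝ) :
    Set ((Fin m → ℝ) × ℝ) :=
  {p | k₀ ≤ p.2 ∧
    (∀ i, c i xs = 0 → δ ≤ p.1 i ∧ |p.1 i - ls i| ≤ δ * p.2) ∧
    (∀ i, c i xs ≠ 0 → 0 ≤ p.1 i ∧ p.1 i ≤ δ * p.2)}

end ExteriorDistance

end

/-! Write σ = f(y) - f(x*), τ = 1/σ. Stationarity of the transformed Lagrangian at x* says that ν =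
σ λ*(y) is a multiplier vector of the original convex problem, and independence of the active
gradients makes ν the same for all centers (`RegularKKT.multiplier_eq`). Hence all local constants
(`LocalEstimates`) are fixed before y, and the center influences δ and k₀ only through the bound τ ≥
1/(M - f(x*)).

Let G = f - f(x*) - ∑ ν_i c_i, which is nonnegative by convexity. The Hessian of G plus the squares
of the active gradients is positive definite at x*, so G + (1/2) ∑ c_i² (sum over active i) grows
quadratically near x*.

The engine is `LocalEstimates.energy_le`. It bounds the inner product of the EDF gradient at x with
x - x* from below by τ G, plus a square in f(x) - f(x*), plus the active sum of (λ*_i - λ̂_i)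
c_i(x), minus a small passive term. It serves twice.

On the sphere of radius r the lower bound is positive (`LocalEstimates.radial_pos`). A minimizer
over the ball therefore lies in its interior and, by convexity, is global. The EDF Hessian dominates
a small multiple of the positive definite form above, which gives local strong convexity and with it
uniqueness.

At the minimizer the inner product vanishes. Put U = |x̂ - x*| and T = ‖λ - λ*‖/k. Stationarity and
independent gradients bound λ̂ - λ* on the active set by a multiple of U + T and keep active λ̂_i
away from 0. The update rule reads λ̂_i c_i = (λ_i - λ*_i)/k - (λ̂_i - λ*_i)/k, which makes the
complementarity terms O(T² + UT). With quadratic growth, U² = O(T² + UT), so U = O(T) with a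
constant free of k and λ (`LocalEstimates.exists_error_bound`). For λ = λ* one has T = 0, which is
the fixed point property. -/

noncomputable section

namespace ExteriorDistance

open Set Filter Topology

/-! ### Gradients, Hessians and convexity in Euclidean space. -/

section Calculus

variable {n : ℕ}

/-- The gradient inequality for differentiable convex functions. -/
theorem gradient_inequality {g : EuclideanSpace ℝ (Fin n) → ℝ} (hg : ConvexOn ℝ univ g)
    {x : EuclideanSpace ℝ (Fin n)} (hx : DifferentiableAt ℝ g x)
    (z : EuclideanSpace ℝ (Fin n)) :
    g x + inner ℝ (gradient g x) (z - x) ≤ g z := by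
  have hline : ConvexOn ℝ univ (g ∘ AffineMap.lineMap (k := ℝ) x z) := by
    simpa using hg.comp_affineMap (AffineMap.lineMap (k := ℝ) x z)
  have hd : HasDerivAt (g ∘ AffineMap.lineMap (k := ℝ) x z)
      (inner ℝ (gradient g x) (z - x)) 0 := by
    have h1 : HasDerivAt (AffineMap.lineMap (k := ℝ) x z) (z - x) (0 : ℝ) :=
      AffineMap.hasDerivAt_lineMap
    have h2 : HasFDerivAt g (fderiv ℝ g x) (AffineMap.lineMap (k := ℝ) x z (0 : ℝ)) := by
      simpa using hx.hasFDerivAt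
    rw [inner_gradient_left]
    exact h2.comp_hasDerivAt 0 h1
  have := hline.le_slope_of_hasDerivAt (mem_univ 0) (mem_univ 1) one_pos hd
  simp only [slope, Function.comp_apply, AffineMap.lineMap_apply_zero,
    AffineMap.lineMap_apply_one, sub_zero, inv_one, one_smul, vsub_eq_sub] at this
  linarith

theorem gradient_inequality_concave {g : EuclideanSpace ℝ (Fin n) → ℝ}
    (hg : ConcaveOn ℝ univ g) {x : EuclideanSpace ℝ (Fin n)} (hx : DifferentiableAt ℝ g x)
    (z : EuclideanSpace ℝ (Fin n)) :
    g z ≤ g x + inner ℝ (gradient g x) (z - x) := by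
  have h := gradient_inequality hg.neg hx.neg z
  have h2 : gradient (-g) x = -gradient g x := by
    simp [gradient, fderiv_neg]
  rw [h2, inner_neg_left] at h
  simp only [Pi.neg_apply] at h
  linarith

/-- A differentiable function with monotone gradient is convex. -/
theorem convexOn_of_monotone_gradient {g : EuclideanSpace ℝ (Fin n) → ℝ}
    {s : Set (EuclideanSpace ℝ (Fin n))} (hs : Convex ℝ s)
    (hd : ∀ x ∈ s, DifferentiableAt ℝ g x)
    (hm : ∀ x ∈ s, ∀ z ∈ s, 0 ≤ inner ℝ (gradient g x - gradient g z) (x - z)) :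
    ConvexOn ℝ s g := by
  refine ⟨hs, fun x hx z hz a b ha hb hab => ?_⟩
  set L : ℝ → EuclideanSpace ℝ (Fin n) := fun t => AffineMap.lineMap x z t with hL
  have hmem : ∀ t ∈ Icc (0 : ℝ) 1, L t ∈ s := fun t ht =>
    hs.lineMap_mem hx hz ht
  have hder : ∀ t ∈ Icc (0 : ℝ) 1,
      HasDerivAt (g ∘ L) (inner ℝ (gradient g (L t)) (z - x)) t := fun t ht => by
    have h1 : HasDerivAt L (z - x) t := AffineMap.hasDerivAt_lineMap
    rw [inner_gradient_left]
    exact (hd _ (hmem t ht)).hasFDerivAt.comp_hasDerivAt t h1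
  have hconv : ConvexOn ℝ (Icc (0 : ℝ) 1) (g ∘ L) := by
    refine MonotoneOn.convexOn_of_deriv (convex_Icc 0 1)
      (fun t ht => (hder t ht).continuousAt.continuousWithinAt)
      (fun t ht => (hder t (interior_subset ht)).differentiableAt.differentiableWithinAt) ?_
    intro t ht u hu htu
    have ht' := interior_subset ht
    have hu' := interior_subset hu
    rw [(hder t ht').deriv, (hder u hu').deriv]
    rcases htu.eq_or_lt with rfl | hlt
    · rfl
    · have h := hm _ (hmem u hu') _ (hmem t ht')
      have h2 : L u - L t = (u - t) • (z - x) := by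
        simp only [hL, AffineMap.lineMap_apply, vsub_eq_sub, vadd_eq_add]
        module
      rw [h2, inner_smul_right, inner_sub_left] at h
      have := nonneg_of_mul_nonneg_right h (sub_pos.2 hlt)
      linarith
  have h := hconv.2 (left_mem_Icc.2 zero_le_one) (right_mem_Icc.2 zero_le_one) ha hb hab
  have h3 : a • x + b • z = L b := by
    simp only [hL, AffineMap.lineMap_apply, vsub_eq_sub, vadd_eq_add]
    rw [← eq_sub_iff_add_eq] at hab
    subst hab
    module
  rw [h3]
  simpa [hL] using h

theorem contDiffAt_gradient {g : EuclideanSpace ℝ (Fin n) → ℝ}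
    {x : EuclideanSpace ℝ (Fin n)} (hg : ContDiffAt ℝ 2 g x) :
    ContDiffAt ℝ 1 (gradient g) x := by
  have h := hg.fderiv_right (m := 1) (by norm_num)
  exact (InnerProductSpace.toDual ℝ (EuclideanSpace ℝ (Fin n))).symm.contDiff.contDiffAt.comp x h

theorem hasFDerivAt_gradient {g : EuclideanSpace ℝ (Fin n) → ℝ}
    {x : EuclideanSpace ℝ (Fin n)} (hg : ContDiffAt ℝ 2 g x) :
    HasFDerivAt (gradient g) (hessian g x) x :=
  ((contDiffAt_gradient hg).differentiableAt one_ne_zero).hasFDerivAt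

theorem eventually_hasGradientAt {g : EuclideanSpace ℝ (Fin n) → ℝ}
    {x : EuclideanSpace ℝ (Fin n)} (hg : ContDiffAt ℝ 2 g x) :
    ∀ᶠ z in 𝓝 x, HasGradientAt g (gradient g z) z := by
  filter_upwards [hg.eventually (by simp)] with z hz
  exact (hz.differentiableAt two_ne_zero).hasGradientAt

/-- A function whose Hessian is positive definite at a point is strongly convex near it. -/
theorem exists_strongConvexOn_ball {g : EuclideanSpace ℝ (Fin n) → ℝ}
    {x : EuclideanSpace ℝ (Fin n)} (hg : ContDiffAt ℝ 2 g x) {μ : ℝ} (hμ : 0 < μ)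
    (hH : ∀ u, μ * ‖u‖ ^ 2 ≤ inner ℝ (hessian g x u) u) :
    ∃ ε : ℝ, 0 < ε ∧ ∀ η ≤ ε, StrongConvexOn (Metric.ball x η) (μ / 2) g := by
  -- Strict differentiability controls gradient differences for both endpoints at once: ∇g(a) -
  -- ∇g(b) differs from H(a - b) by at most (μ/2)|a - b|. So ∇g - (μ/2) id is still monotone near x.
  have hs : HasStrictFDerivAt (gradient g) (hessian g x) x :=
    (contDiffAt_gradient hg).hasStrictFDerivAt one_ne_zero
  have h1 := hs.isLittleO.def (half_pos hμ)
  obtain ⟨ε₁, hε₁, h1⟩ := Metric.eventually_nhds_iff_ball.1 h1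
  obtain ⟨ε₂, hε₂, h2⟩ := Metric.eventually_nhds_iff_ball.1 (eventually_hasGradientAt hg)
  refine ⟨min ε₁ ε₂, lt_min hε₁ hε₂, fun η hη => ?_⟩
  rw [strongConvexOn_iff_convex]
  have hgrad : ∀ z ∈ Metric.ball x η,
      HasGradientAt (fun z => g z - μ / 2 / 2 * ‖z‖ ^ 2) (gradient g z - (μ / 2) • z) z := by
    intro z hz
    have hz2 := h2 z (Metric.ball_subset_ball (hη.trans (min_le_right _ _)) hz)
    have h3 : HasFDerivAt (fun z : EuclideanSpace ℝ (Fin n) => ‖z‖ ^ 2) (2 • (innerSL ℝ) z) z :=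
      (hasStrictFDerivAt_norm_sq z).hasFDerivAt
    rw [hasGradientAt_iff_hasFDerivAt] at hz2 ⊢
    refine (hz2.sub (h3.const_mul (μ / 2 / 2))).congr_fderiv ?_
    ext v
    simp
    ring
  refine convexOn_of_monotone_gradient (convex_ball x η)
    (fun z hz => (hgrad z hz).differentiableAt) ?_
  intro a ha b hb
  rw [(hgrad a ha).gradient, (hgrad b hb).gradient]
  have hab : (a, b) ∈ Metric.ball (x, x) ε₁ := by
    rw [← ball_prod_same]
    exact ⟨Metric.ball_subset_ball (hη.trans (min_le_left _ _)) ha,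
      Metric.ball_subset_ball (hη.trans (min_le_left _ _)) hb⟩
  have h4 := h1 _ hab
  simp only at h4
  have h5 : |inner ℝ (gradient g a - gradient g b - hessian g x (a - b)) (a - b)|
      ≤ μ / 2 * ‖a - b‖ * ‖a - b‖ :=
    (abs_real_inner_le_norm _ _).trans (by gcongr)
  have h6 := hH (a - b)
  have h7 : gradient g a - (μ / 2) • a - (gradient g b - (μ / 2) • b)
      = (gradient g a - gradient g b - hessian g x (a - b)) + hessian g x (a - b)
        - (μ / 2) • (a - b) := by module
  rw [h7, inner_sub_left, inner_add_left, inner_smul_left, real_inner_self_eq_norm_sq]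
  have h8 := (abs_le.1 h5).1
  simp only [conj_trivial]
  nlinarith

/-- The form is the derivative at 0 of the slope of g along the line x + t u. That slope is
monotone: add the gradient inequalities for two points of the line. -/
theorem hessian_inner_nonneg_of_convexOn {g : EuclideanSpace ℝ (Fin n) → ℝ}
    (hg : ContDiff ℝ 2 g) (hconv : ConvexOn ℝ univ g) (x u : EuclideanSpace ℝ (Fin n)) :
    0 ≤ inner ℝ (hessian g x u) u := by
  have hH := hasFDerivAt_gradient (hg.contDiffAt (x := x))
  have hl : HasDerivAt (fun t : ℝ => inner ℝ (gradient g (x + t • u)) u)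
      (inner ℝ (hessian g x u) u) 0 := by
    have h1 : HasDerivAt (fun t : ℝ => x + t • u) u 0 := by
      simpa using ((hasDerivAt_id (0 : ℝ)).smul_const u).const_add x
    have h2 : HasDerivAt (fun t : ℝ => gradient g (x + t • u)) (hessian g x u) 0 := by
      have h0 : HasFDerivAt (gradient g) (hessian g x) (x + (0 : ℝ) • u) := by simpa using hH
      exact h0.comp_hasDerivAt 0 h1
    simpa using h2.inner ℝ (hasDerivAt_const (0 : ℝ) u)
  rw [← hl.deriv]
  refine Monotone.deriv_nonneg ?_
  intro s t hst
  rcases hst.eq_or_lt with rfl | hlt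
  · rfl
  have hd : Differentiable ℝ g := hg.differentiable two_ne_zero
  have h1 := gradient_inequality hconv (hd (x + s • u)) (x + t • u)
  have h2 := gradient_inequality hconv (hd (x + t • u)) (x + s • u)
  have e1 : x + t • u - (x + s • u) = (t - s) • u := by module
  have e2 : x + s • u - (x + t • u) = -((t - s) • u) := by module
  rw [e1, inner_smul_right] at h1
  rw [e2, inner_neg_right, inner_smul_right] at h2
  have h3 : 0 < t - s := sub_pos.2 hlt
  simp only
  nlinarith

theorem hessian_inner_nonpos_of_concaveOn {g : EuclideanSpace ℝ (Fin n) → ℝ}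
    (hg : ContDiff ℝ 2 g) (hconc : ConcaveOn ℝ univ g) (x u : EuclideanSpace ℝ (Fin n)) :
    inner ℝ (hessian g x u) u ≤ 0 := by
  have h := hessian_inner_nonneg_of_convexOn hg.neg hconc.neg x u
  have h1 : gradient (-g) = -gradient g := by
    ext1 z; simp [gradient, fderiv_neg]
  have h2 : hessian (-g) x = -hessian g x := by
    rw [hessian, h1, fderiv_neg]; rfl
  change 0 ≤ inner ℝ (hessian (-g) x u) u at h
  rw [h2] at h
  simpa [inner_neg_left] using h

/-- If `g` has gradient `G` near `x` and `G` has derivative `H` at `x`, then `H` is the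
Hessian of `g`. -/
theorem hessian_eq {g : EuclideanSpace ℝ (Fin n) → ℝ}
    {G : EuclideanSpace ℝ (Fin n) → EuclideanSpace ℝ (Fin n)} {x : EuclideanSpace ℝ (Fin n)}
    {H : EuclideanSpace ℝ (Fin n) →L[ℝ] EuclideanSpace ℝ (Fin n)}
    (hG : ∀ᶠ z in 𝓝 x, HasGradientAt g (G z) z) (hH : HasFDerivAt G H x) :
    hessian g x = H := by
  have h : gradient g =ᶠ[𝓝 x] G := hG.mono fun z hz => hz.gradient
  exact (hH.congr_of_eventuallyEq h).fderiv

theorem hasGradientAt_comp {g : EuclideanSpace ℝ (Fin n) → ℝ} {x G : EuclideanSpace ℝ (Fin n)}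
    {h : ℝ → ℝ} {h' : ℝ} (hh : HasDerivAt h h' (g x)) (hg : HasGradientAt g G x) :
    HasGradientAt (fun z => h (g z)) (h' • G) x := by
  rw [hasGradientAt_iff_hasFDerivAt] at hg ⊢
  refine (hh.comp_hasFDerivAt x hg).congr_fderiv ?_
  simp

theorem hasGradientAt_add {g₁ g₂ : EuclideanSpace ℝ (Fin n) → ℝ}
    {x G₁ G₂ : EuclideanSpace ℝ (Fin n)}
    (h₁ : HasGradientAt g₁ G₁ x) (h₂ : HasGradientAt g₂ G₂ x) :
    HasGradientAt (fun z => g₁ z + g₂ z) (G₁ + G₂) x := by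
  rw [hasGradientAt_iff_hasFDerivAt] at *
  exact (h₁.add h₂).congr_fderiv (by simp)

theorem hasGradientAt_sum {ι : Type*} {s : Finset ι} {g : ι → EuclideanSpace ℝ (Fin n) → ℝ}
    {x : EuclideanSpace ℝ (Fin n)} {G : ι → EuclideanSpace ℝ (Fin n)}
    (h : ∀ i ∈ s, HasGradientAt (g i) (G i) x) :
    HasGradientAt (fun z => ∑ i ∈ s, g i z) (∑ i ∈ s, G i) x := by
  simp only [hasGradientAt_iff_hasFDerivAt] at *
  exact (HasFDerivAt.fun_sum h).congr_fderiv (by simp)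

/-- Gradient of `x ↦ h₀ (f x) + ∑ h i (c i x)`. -/
theorem hasGradientAt_separable {m : ℕ} {f : EuclideanSpace ℝ (Fin n) → ℝ}
    {c : Fin m → EuclideanSpace ℝ (Fin n) → ℝ} {x : EuclideanSpace ℝ (Fin n)}
    {p : ℝ → ℝ} {p' : ℝ} {q : Fin m → ℝ → ℝ} {q' : Fin m → ℝ}
    (hf : DifferentiableAt ℝ f x) (hc : ∀ i, DifferentiableAt ℝ (c i) x)
    (hp : HasDerivAt p p' (f x)) (hq : ∀ i, HasDerivAt (q i) (q' i) (c i x)) :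
    HasGradientAt (fun z => p (f z) + ∑ i, q i (c i z))
      (p' • gradient f x + ∑ i, q' i • gradient (c i) x) x :=
  hasGradientAt_add (hasGradientAt_comp hp hf.hasGradientAt)
    (hasGradientAt_sum fun i _ => hasGradientAt_comp (hq i) (hc i).hasGradientAt)

/-- Hessian form of `x ↦ h₀ (f x) + ∑ h i (c i x)`. -/
theorem hessian_separable_inner {m : ℕ} {f : EuclideanSpace ℝ (Fin n) → ℝ}
    {c : Fin m → EuclideanSpace ℝ (Fin n) → ℝ} {x : EuclideanSpace ℝ (Fin n)}
    {p p' : ℝ → ℝ} {p'' : ℝ} {q q' : Fin m → ℝ → ℝ} {q'' : Fin m → ℝ}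
    (hf : ContDiff ℝ 2 f) (hc : ∀ i, ContDiff ℝ 2 (c i))
    (hp : ∀ᶠ v in 𝓝 (f x), HasDerivAt p (p' v) v)
    (hq : ∀ i, ∀ᶠ v in 𝓝 (c i x), HasDerivAt (q i) (q' i v) v)
    (hp' : HasDerivAt p' p'' (f x)) (hq' : ∀ i, HasDerivAt (q' i) (q'' i) (c i x))
    (u : EuclideanSpace ℝ (Fin n)) :
    inner ℝ (hessian (fun z => p (f z) + ∑ i, q i (c i z)) x u) u
      = (p' (f x) * inner ℝ (hessian f x u) u + p'' * inner ℝ (gradient f x) u ^ 2)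
        + ∑ i, (q' i (c i x) * inner ℝ (hessian (c i) x u) u
          + q'' i * inner ℝ (gradient (c i) x) u ^ 2) := by
  have hG : ∀ᶠ z in 𝓝 x, HasGradientAt (fun z => p (f z) + ∑ i, q i (c i z))
      (p' (f z) • gradient f z + ∑ i, q' i (c i z) • gradient (c i) z) z := by
    filter_upwards [hf.continuous.continuousAt.eventually hp,
      eventually_all.2 fun i => (hc i).continuous.continuousAt.eventually (hq i)] with z h1 h2
    exact hasGradientAt_separable (hf.differentiable two_ne_zero z)
      (fun i => (hc i).differentiable two_ne_zero z) h1 h2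
  have key : ∀ {g : EuclideanSpace ℝ (Fin n) → ℝ} {r' : ℝ → ℝ} {r'' : ℝ}
      (_ : ContDiff ℝ 2 g) (_ : HasDerivAt r' r'' (g x)),
      HasFDerivAt (fun z => r' (g z) • gradient g z)
        (r' (g x) • hessian g x + (r'' • fderiv ℝ g x).smulRight (gradient g x)) x := by
    intro g r' r'' hg hr
    exact (hr.comp_hasFDerivAt x (hg.differentiable two_ne_zero x).hasFDerivAt).fun_smul
      (hasFDerivAt_gradient hg.contDiffAt)
  have hH := (key hf hp').add (HasFDerivAt.fun_sum (u := Finset.univ) fun i _ => key (hc i) (hq' i))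
  rw [hessian_eq hG hH]
  simp only [add_apply, sum_apply,
    smul_apply, ContinuousLinearMap.smulRight_apply, inner_add_left,
    sum_inner, inner_smul_left, smul_eq_mul, conj_trivial, inner_gradient_left]
  congr 1
  · ring
  · exact Finset.sum_congr rfl fun i _ => by ring

theorem continuous_gradient {g : EuclideanSpace ℝ (Fin n) → ℝ} (hg : ContDiff ℝ 2 g) :
    Continuous (gradient g) :=
  continuous_iff_continuousAt.2 fun _ => (contDiffAt_gradient hg.contDiffAt).continuousAt

theorem continuous_hessian {g : EuclideanSpace ℝ (Fin n) → ℝ} (hg : ContDiff ℝ 2 g) :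
    Continuous (hessian g) :=
  (contDiff_iff_contDiffAt.2 fun _ => contDiffAt_gradient hg.contDiffAt).continuous_fderiv
    one_ne_zero

end Calculus

end ExteriorDistance

end

noncomputable section

namespace ExteriorDistance

open Set Filter Topology

/-! ### Center-independent estimates near a regular KKT point. -/

section LocalGeometry

variable {n m : ℕ}

/-- The indices of the constraints that are active at `x`. -/
def activeSet (c : Fin m → EuclideanSpace ℝ (Fin n) → ℝ) (x : EuclideanSpace ℝ (Fin n)) :
    Finset (Fin m) :=
  Finset.univ.filter fun i => c i x = 0

theorem mem_activeSet {c : Fin m → EuclideanSpace ℝ (Fin n) → ℝ}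
    {x : EuclideanSpace ℝ (Fin n)} {i : Fin m} : i ∈ activeSet c x ↔ c i x = 0 := by
  simp [activeSet]

/-- Strict Karush-Kuhn-Tucker conditions and second order sufficient condition for
`min {f x : c i x ≥ 0}` at `(x, ν)`, together with the independence of the active gradients. -/
structure RegularKKT (f : EuclideanSpace ℝ (Fin n) → ℝ)
    (c : Fin m → EuclideanSpace ℝ (Fin n) → ℝ) (x : EuclideanSpace ℝ (Fin n))
    (ν : Fin m → ℝ) : Prop where
  feasible : ∀ i, 0 ≤ c i x
  stationary : gradient f x = ∑ i, ν i • gradient (c i) x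
  passive_eq : ∀ i, i ∉ activeSet c x → ν i = 0
  active_pos : ∀ i ∈ activeSet c x, 0 < ν i
  curvature : ∀ u : EuclideanSpace ℝ (Fin n), u ≠ 0 →
    (∀ i ∈ activeSet c x, inner ℝ (gradient (c i) x) u = 0) →
      0 < inner ℝ (hessian f x u) u - ∑ i, ν i * inner ℝ (hessian (c i) x u) u
  independent : LinearIndependent ℝ fun i : {i // i ∈ activeSet c x} => gradient (c i.1) x

/-- Uniform estimates on the closed ball of radius `r` about the solution. -/
structure LocalEstimates (f : EuclideanSpace ℝ (Fin n) → ℝ)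
    (c : Fin m → EuclideanSpace ℝ (Fin n) → ℝ) (xs : EuclideanSpace ℝ (Fin n))
    (ν : Fin m → ℝ) (r κ γ B α K νm : ℝ) : Prop where
  r_pos : 0 < r
  κ_pos : 0 < κ
  γ_pos : 0 < γ
  B_nonneg : 0 ≤ B
  α_pos : 0 < α
  K_nonneg : 0 ≤ K
  νm_pos : 0 < νm
  le_multiplier : ∀ i ∈ activeSet c xs, νm ≤ ν i
  growth : ∀ x ∈ Metric.closedBall xs r, κ * ‖x - xs‖ ^ 2 ≤
    (f x - f xs - ∑ i, ν i * c i x) + 1 / 2 * ∑ i ∈ activeSet c xs, c i x ^ 2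
  posdef : ∀ x ∈ Metric.closedBall xs r, ∀ u : EuclideanSpace ℝ (Fin n), κ * ‖u‖ ^ 2 ≤
    inner ℝ (hessian f x u) u - ∑ i, ν i * inner ℝ (hessian (c i) x u) u
      + ∑ i ∈ activeSet c xs, inner ℝ (gradient (c i) x) u ^ 2
  passive : ∀ x ∈ Metric.closedBall xs r, ∀ i, i ∉ activeSet c xs → γ ≤ c i x
  gradient_le : ∀ x ∈ Metric.closedBall xs r, ∀ i, ‖gradient (c i) x‖ ≤ B
  objective_le : ∀ x ∈ Metric.closedBall xs r, |f x - f xs| ≤ B * ‖x - xs‖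
  independent : ∀ x ∈ Metric.closedBall xs r, ∀ a : Fin m → ℝ, ∀ i ∈ activeSet c xs,
    α * |a i| ≤ ‖∑ j ∈ activeSet c xs, a j • gradient (c j) x‖
  residual : ∀ x ∈ Metric.closedBall xs r,
    ‖gradient f x - ∑ i, ν i • gradient (c i) x‖ ≤ K * ‖x - xs‖
  -- Keeps the stationarity residual on the ball so small that it costs at most a quarter of `νm` in
  -- the updated active multipliers.
  radius_le : K * r ≤ α * νm / 4

variable {f : EuclideanSpace ℝ (Fin n) → ℝ} {c : Fin m → EuclideanSpace ℝ (Fin n) → ℝ}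
  {xs : EuclideanSpace ℝ (Fin n)} {ν : Fin m → ℝ}

theorem RegularKKT.multiplier_nonneg (h : RegularKKT f c xs ν) (i : Fin m) : 0 ≤ ν i := by
  by_cases hi : i ∈ activeSet c xs
  · exact (h.active_pos i hi).le
  · exact (h.passive_eq i hi).ge

theorem RegularKKT.complementary (h : RegularKKT f c xs ν) (i : Fin m) : ν i * c i xs = 0 := by
  by_cases hi : i ∈ activeSet c xs
  · rw [mem_activeSet.1 hi, mul_zero]
  · rw [h.passive_eq i hi, zero_mul]

/-- The Lagrangian of the convex problem is minimal at a KKT point. -/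
theorem RegularKKT.lagrangian_nonneg (h : RegularKKT f c xs ν)
    (hf : ContDiff ℝ 2 f) (hc : ∀ i, ContDiff ℝ 2 (c i))
    (hfconv : ConvexOn ℝ univ f) (hcconc : ∀ i, ConcaveOn ℝ univ (c i))
    (x : EuclideanSpace ℝ (Fin n)) : 0 ≤ f x - f xs - ∑ i, ν i * c i x := by
  have h1 := gradient_inequality hfconv (hf.differentiable two_ne_zero xs) x
  have h2 : ∑ i, ν i * c i x ≤ ∑ i, ν i * inner ℝ (gradient (c i) xs) (x - xs) := by
    refine Finset.sum_le_sum fun i _ => ?_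
    have h3 := mul_le_mul_of_nonneg_left (gradient_inequality_concave (hcconc i)
      ((hc i).differentiable two_ne_zero xs) x) (h.multiplier_nonneg i)
    rw [mul_add, h.complementary i, zero_add] at h3
    exact h3
  have h4 : inner ℝ (gradient f xs) (x - xs)
      = ∑ i, ν i * inner ℝ (gradient (c i) xs) (x - xs) := by
    rw [h.stationary, sum_inner]
    simp [inner_smul_left]
  linarith

/-- The Hessian of the Lagrangian plus the squares of the active constraints. -/
def penalizedHessian (f : EuclideanSpace ℝ (Fin n) → ℝ)
    (c : Fin m → EuclideanSpace ℝ (Fin n) → ℝ) (xs : EuclideanSpace ℝ (Fin n))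
    (ν : Fin m → ℝ) (x : EuclideanSpace ℝ (Fin n)) :
    EuclideanSpace ℝ (Fin n) →L[ℝ] EuclideanSpace ℝ (Fin n) :=
  hessian f x - ∑ i, ν i • hessian (c i) x
    + ∑ i ∈ activeSet c xs,
      (ContinuousLinearMap.smulRightL ℝ _ _ (innerSL ℝ (gradient (c i) x)) (gradient (c i) x))

theorem penalizedHessian_inner (x u : EuclideanSpace ℝ (Fin n)) :
    inner ℝ (penalizedHessian f c xs ν x u) u =
      inner ℝ (hessian f x u) u - ∑ i, ν i * inner ℝ (hessian (c i) x u) u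
        + ∑ i ∈ activeSet c xs, inner ℝ (gradient (c i) x) u ^ 2 := by
  simp only [penalizedHessian, add_apply, sub_apply, sum_apply, smul_apply, inner_add_left,
    inner_sub_left, sum_inner, inner_smul_left, conj_trivial,
    ContinuousLinearMap.smulRightL_apply_apply, ContinuousLinearMap.smulRight_apply,
    innerSL_apply_apply, sq]

theorem continuous_penalizedHessian (hf : ContDiff ℝ 2 f) (hc : ∀ i, ContDiff ℝ 2 (c i)) :
    Continuous (penalizedHessian f c xs ν) := by
  have h1 := continuous_hessian hf
  have h2 := fun i => continuous_hessian (hc i)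
  have h3 := fun i => continuous_gradient (hc i)
  unfold penalizedHessian
  fun_prop

theorem exists_posdef_of_pos {H : EuclideanSpace ℝ (Fin n) →L[ℝ] EuclideanSpace ℝ (Fin n)}
    (hH : ∀ u, u ≠ 0 → 0 < inner ℝ (H u) u) :
    ∃ κ : ℝ, 0 < κ ∧ ∀ u, κ * ‖u‖ ^ 2 ≤ inner ℝ (H u) u := by
  -- The unit sphere is empty exactly when n = 0.
  rcases (Metric.sphere (0 : EuclideanSpace ℝ (Fin n)) 1).eq_empty_or_nonempty with he | hne
  · refine ⟨1, one_pos, fun u => ?_⟩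
    have hu : u = 0 := by
      by_contra hu
      have : ‖u‖⁻¹ • u ∈ Metric.sphere (0 : EuclideanSpace ℝ (Fin n)) 1 := by
        simp [norm_smul, hu]
      simp [he] at this
    simp [hu]
  · obtain ⟨v, hv, hmin⟩ := (isCompact_sphere (0 : EuclideanSpace ℝ (Fin n)) 1).exists_isMinOn
      hne (f := fun u => inner ℝ (H u) u) (by fun_prop)
    have hv0 : v ≠ 0 := by rintro rfl; simp at hv
    refine ⟨inner ℝ (H v) v, hH v hv0, fun u => ?_⟩
    by_cases hu : u = 0
    · simp [hu]
    have hun : 0 < ‖u‖ := norm_pos_iff.2 hu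
    have h1 : inner ℝ (H v) v ≤ inner ℝ (H (‖u‖⁻¹ • u)) (‖u‖⁻¹ • u) :=
      hmin (by simp [norm_smul, hu])
    rw [map_smul, inner_smul_left, inner_smul_right] at h1
    simp only [conj_trivial] at h1
    have h2 : inner ℝ (H u) u = ‖u‖ ^ 2 * (‖u‖⁻¹ * (‖u‖⁻¹ * inner ℝ (H u) u)) := by
      field_simp
    rw [h2, mul_comm]
    gcongr

/-- On the kernel of the active gradients this is the second-order condition. Off the kernel the
squares are positive, and the Lagrangian Hessian is nonnegative by convexity. Therefore weight one
on the squares suffices, and no large penalty parameter is needed. -/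
theorem RegularKKT.exists_posdef (h : RegularKKT f c xs ν)
    (hf : ContDiff ℝ 2 f) (hc : ∀ i, ContDiff ℝ 2 (c i))
    (hfconv : ConvexOn ℝ univ f) (hcconc : ∀ i, ConcaveOn ℝ univ (c i)) :
    ∃ κ : ℝ, 0 < κ ∧ ∀ u, κ * ‖u‖ ^ 2 ≤ inner ℝ (penalizedHessian f c xs ν xs u) u := by
  refine exists_posdef_of_pos fun u hu => ?_
  rw [penalizedHessian_inner]
  have h3 : 0 ≤ ∑ i ∈ activeSet c xs, inner ℝ (gradient (c i) xs) u ^ 2 :=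
    Finset.sum_nonneg fun i _ => sq_nonneg _
  by_cases hA : ∀ i ∈ activeSet c xs, inner ℝ (gradient (c i) xs) u = 0
  · linarith [h.curvature u hu hA]
  · push Not at hA
    obtain ⟨i, hi, hiu⟩ := hA
    have h1 := hessian_inner_nonneg_of_convexOn hf hfconv xs u
    have h2 : ∑ i, ν i * inner ℝ (hessian (c i) xs u) u ≤ 0 :=
      Finset.sum_nonpos fun i _ => mul_nonpos_of_nonneg_of_nonpos (h.multiplier_nonneg i)
        (hessian_inner_nonpos_of_concaveOn (hc i) (hcconc i) xs u)
    have h4 : 0 < ∑ i ∈ activeSet c xs, inner ℝ (gradient (c i) xs) u ^ 2 :=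
      Finset.sum_pos' (fun i _ => sq_nonneg _) ⟨i, hi, by positivity⟩
    linarith

theorem RegularKKT.eventually_posdef (h : RegularKKT f c xs ν)
    (hf : ContDiff ℝ 2 f) (hc : ∀ i, ContDiff ℝ 2 (c i))
    (hfconv : ConvexOn ℝ univ f) (hcconc : ∀ i, ConcaveOn ℝ univ (c i)) :
    ∃ κ : ℝ, 0 < κ ∧ ∀ᶠ x in 𝓝 xs, ∀ u : EuclideanSpace ℝ (Fin n), κ * ‖u‖ ^ 2 ≤
      inner ℝ (hessian f x u) u - ∑ i, ν i * inner ℝ (hessian (c i) x u) u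
        + ∑ i ∈ activeSet c xs, inner ℝ (gradient (c i) x) u ^ 2 := by
  obtain ⟨κ, hκ, hpos⟩ := h.exists_posdef hf hc hfconv hcconc
  refine ⟨κ / 2, half_pos hκ, ?_⟩
  have h1 := (continuous_penalizedHessian (xs := xs) (ν := ν) hf hc).continuousAt (x := xs)
  filter_upwards [Metric.continuousAt_iff'.1 h1 (κ / 2) (half_pos hκ)] with x hx u
  rw [← penalizedHessian_inner]
  rw [dist_eq_norm] at hx
  have h2 : |inner ℝ ((penalizedHessian f c xs ν x - penalizedHessian f c xs ν xs) u) u|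
      ≤ κ / 2 * ‖u‖ * ‖u‖ := by
    refine (abs_real_inner_le_norm _ _).trans ?_
    gcongr
    exact ContinuousLinearMap.le_of_opNorm_le _ hx.le u
  rw [sub_apply, inner_sub_left] at h2
  have := (abs_le.1 h2).1
  nlinarith [hpos u]

/-- The function W, the Lagrangian plus half the squared active constraints, has a global minimum at
`xs` and a positive definite Hessian there. It is strongly convex nearby, and that forces quadratic
growth. -/
theorem RegularKKT.eventually_growth (h : RegularKKT f c xs ν)
    (hf : ContDiff ℝ 2 f) (hc : ∀ i, ContDiff ℝ 2 (c i))
    (hfconv : ConvexOn ℝ univ f) (hcconc : ∀ i, ConcaveOn ℝ univ (c i)) :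
    ∃ κ : ℝ, 0 < κ ∧ ∀ᶠ x in 𝓝 xs, κ * ‖x - xs‖ ^ 2 ≤
      (f x - f xs - ∑ i, ν i * c i x) + 1 / 2 * ∑ i ∈ activeSet c xs, c i x ^ 2 := by
  obtain ⟨κ, hκ, hpos⟩ := h.exists_posdef hf hc hfconv hcconc
  set e : Fin m → ℝ := fun i => if i ∈ activeSet c xs then 1 else 0 with he
  set W : EuclideanSpace ℝ (Fin n) → ℝ :=
    fun z => id (f z) + ∑ i, (fun v : ℝ => -ν i * v + e i / 2 * v ^ 2) (c i z) with hW
  have hWeq : ∀ x, W x = f x - ∑ i, ν i * c i x + 1 / 2 * ∑ i ∈ activeSet c xs, c i x ^ 2 := by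
    intro x
    have h1 : ∑ i ∈ activeSet c xs, c i x ^ 2 = ∑ i, e i * c i x ^ 2 := by
      simp [he, Finset.sum_ite_mem]
    rw [h1, Finset.mul_sum, sub_add, ← Finset.sum_sub_distrib, sub_eq_add_neg,
      ← Finset.sum_neg_distrib]
    simp only [hW, id]
    congr 1
    exact Finset.sum_congr rfl fun i _ => by ring
  have hWxs : W xs = f xs := by
    rw [hWeq]
    have h1 : ∑ i, ν i * c i xs = 0 := Finset.sum_eq_zero fun i _ => h.complementary i
    have h2 : ∑ i ∈ activeSet c xs, c i xs ^ 2 = 0 :=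
      Finset.sum_eq_zero fun i hi => by rw [mem_activeSet.1 hi]; norm_num
    rw [h1, h2]; ring
  have hWmin : ∀ x, W xs ≤ W x := by
    intro x
    have h1 := h.lagrangian_nonneg hf hc hfconv hcconc x
    have h2 : 0 ≤ ∑ i ∈ activeSet c xs, c i x ^ 2 := Finset.sum_nonneg fun i _ => sq_nonneg _
    rw [hWxs, hWeq]; linarith
  have hWcont : ContDiffAt ℝ 2 W xs := by
    refine ContDiff.contDiffAt ?_
    simp only [hW, id]
    exact hf.add (ContDiff.sum fun i _ =>
      (contDiff_const.mul (hc i)).add (contDiff_const.mul ((hc i).pow 2)))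
  have hWH : ∀ u, κ * ‖u‖ ^ 2 ≤ inner ℝ (hessian W xs u) u := by
    intro u
    have hq : ∀ (i : Fin m) (v : ℝ), HasDerivAt (fun v : ℝ => -ν i * v + e i / 2 * v ^ 2)
        (-ν i + e i * v) v := by
      intro i v
      refine (((hasDerivAt_id v).const_mul (-ν i)).add
        ((hasDerivAt_pow 2 v).const_mul (e i / 2))).congr_deriv ?_
      simp; ring
    have hq' : ∀ (i : Fin m) (v : ℝ), HasDerivAt (fun v : ℝ => -ν i + e i * v) (e i) v := by
      intro i v
      refine (((hasDerivAt_id v).const_mul (e i)).const_add (-ν i)).congr_deriv ?_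
      simp
    have := hessian_separable_inner (x := xs) (p := id) (p' := fun _ => 1) (p'' := 0) hf hc
      (Eventually.of_forall fun v => hasDerivAt_id v)
      (fun i => Eventually.of_forall fun v => hq i v) (hasDerivAt_const _ _)
      (fun i => hq' i _) u
    rw [hW, this]
    refine (hpos u).trans_eq ?_
    rw [penalizedHessian_inner]
    have h1 : ∑ i ∈ activeSet c xs, inner ℝ (gradient (c i) xs) u ^ 2
        = ∑ i, e i * inner ℝ (gradient (c i) xs) u ^ 2 := by
      simp [he, Finset.sum_ite_mem]
    rw [h1, sub_add, ← Finset.sum_sub_distrib, sub_eq_add_neg, ← Finset.sum_neg_distrib]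
    congr 1
    · ring
    refine Finset.sum_congr rfl fun i _ => ?_
    have h2 : e i * c i xs = 0 := by
      by_cases hi : i ∈ activeSet c xs
      · rw [mem_activeSet.1 hi, mul_zero]
      · simp [he, hi]
    rw [h2]; ring
  obtain ⟨ε, hε, hstrong⟩ := exists_strongConvexOn_ball hWcont hκ hWH
  -- Strong convexity of modulus κ/2 at the midpoint of x and `xs` gains (κ/16)|x - xs|². Since W at
  -- the midpoint is at least W(xs), twice this gain bounds W(x) - W(xs) from below.
  refine ⟨κ / 8, by positivity, ?_⟩
  filter_upwards [Metric.ball_mem_nhds xs hε] with x hx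
  have h1 := (hstrong ε le_rfl).2 hx (Metric.mem_ball_self hε)
    (by norm_num : (0 : ℝ) ≤ 1 / 2) (by norm_num : (0 : ℝ) ≤ 1 / 2) (by norm_num)
  have h2 := hWmin ((1 / 2 : ℝ) • x + (1 / 2 : ℝ) • xs)
  simp only [smul_eq_mul] at h1
  have h3 := hWeq x
  rw [← hWxs]
  nlinarith

/-- At `xs` an injective linear map in finite dimension is bounded below by 1/L. The gradients move
by at most 1/(2L) in total near `xs`, so half of that bound survives. -/
theorem eventually_independent (hc : ∀ i, ContDiff ℝ 2 (c i))
    (h : LinearIndependent ℝ fun i : {i // i ∈ activeSet c xs} => gradient (c i.1) xs) :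
    ∃ α : ℝ, 0 < α ∧ ∀ᶠ x in 𝓝 xs, ∀ a : Fin m → ℝ, ∀ i ∈ activeSet c xs,
      α * |a i| ≤ ‖∑ j ∈ activeSet c xs, a j • gradient (c j) x‖ := by
  obtain ⟨L, hL, hanti⟩ := LinearMap.exists_antilipschitzWith
    (Fintype.linearCombination ℝ fun i : {i // i ∈ activeSet c xs} => gradient (c i.1) xs)
    (LinearMap.ker_eq_bot.2 (linearIndependent_iff_injective_fintypeLinearCombination.1 h))
  have hL' : (0 : ℝ) < L := hL
  set S := activeSet c xs with hS
  have hcont : ContinuousAt (fun x => ∑ j ∈ S, ‖gradient (c j) x - gradient (c j) xs‖) xs := by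
    have := fun i => continuous_gradient (hc i)
    fun_prop
  have hev := Metric.continuousAt_iff'.1 hcont (1 / (2 * L)) (by positivity)
  refine ⟨1 / (2 * L), by positivity, ?_⟩
  filter_upwards [hev] with x hx a i hi
  simp only [sub_self, norm_zero, Finset.sum_const_zero, dist_zero_right, Real.norm_eq_abs] at hx
  have hx := (le_abs_self _).trans hx.le
  set b : {i // i ∈ S} → ℝ := fun i => a i.1 with hb
  have h1 : ‖b‖ ≤ L * ‖∑ j ∈ S, a j • gradient (c j) xs‖ := by
    have := hanti.le_mul_dist b 0
    rw [map_zero, dist_zero_right, dist_zero_right, Fintype.linearCombination_apply] at this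
    rwa [← Finset.sum_coe_sort S fun j => a j • gradient (c j) xs]
  have h2 : ∀ j ∈ S, |a j| ≤ ‖b‖ := fun j hj => norm_le_pi_norm b ⟨j, hj⟩
  have h3 : ‖∑ j ∈ S, a j • gradient (c j) xs‖
      ≤ ‖∑ j ∈ S, a j • gradient (c j) x‖ + ‖b‖ * (1 / (2 * L)) := by
    have h4 : ∑ j ∈ S, a j • gradient (c j) xs = ∑ j ∈ S, a j • gradient (c j) x
        - ∑ j ∈ S, a j • (gradient (c j) x - gradient (c j) xs) := by
      rw [← Finset.sum_sub_distrib]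
      exact Finset.sum_congr rfl fun j _ => by module
    rw [h4]
    refine (norm_sub_le _ _).trans (add_le_add le_rfl ?_)
    refine (norm_sum_le _ _).trans ?_
    calc ∑ j ∈ S, ‖a j • (gradient (c j) x - gradient (c j) xs)‖
        ≤ ∑ j ∈ S, ‖b‖ * ‖gradient (c j) x - gradient (c j) xs‖ := by
          refine Finset.sum_le_sum fun j hj => ?_
          rw [norm_smul]
          exact mul_le_mul_of_nonneg_right (h2 j hj) (norm_nonneg _)
      _ = ‖b‖ * ∑ j ∈ S, ‖gradient (c j) x - gradient (c j) xs‖ := by rw [Finset.mul_sum]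
      _ ≤ _ := mul_le_mul_of_nonneg_left hx (norm_nonneg _)
  have h5 : ‖b‖ ≤ L * (‖∑ j ∈ S, a j • gradient (c j) x‖ + ‖b‖ * (1 / (2 * L))) :=
    h1.trans (mul_le_mul_of_nonneg_left h3 hL'.le)
  have h6 : L * (‖∑ j ∈ S, a j • gradient (c j) x‖ + ‖b‖ * (1 / (2 * L)))
      = L * ‖∑ j ∈ S, a j • gradient (c j) x‖ + ‖b‖ / 2 := by
    field_simp
  rw [h6] at h5
  rw [div_mul_eq_mul_div, one_mul, div_le_iff₀ (by positivity)]
  linarith [h2 i hi]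

/-- Near a regular KKT point of a convex problem the local estimates hold. -/
theorem RegularKKT.exists_localEstimates (h : RegularKKT f c xs ν)
    (hf : ContDiff ℝ 2 f) (hc : ∀ i, ContDiff ℝ 2 (c i))
    (hfconv : ConvexOn ℝ univ f) (hcconc : ∀ i, ConcaveOn ℝ univ (c i)) :
    ∃ r κ γ B α K νm : ℝ, LocalEstimates f c xs ν r κ γ B α K νm := by
  obtain ⟨κ₁, hκ₁, hev₁⟩ := h.eventually_posdef hf hc hfconv hcconc
  obtain ⟨κ₂, hκ₂, hev₂⟩ := h.eventually_growth hf hc hfconv hcconc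
  obtain ⟨α, hα, hev₃⟩ := eventually_independent hc h.independent
  -- A sufficiently small positive number is used instead of a minimum, so that an empty active set
  -- needs no separate case.
  have hνm : ∃ νm : ℝ, 0 < νm ∧ ∀ i ∈ activeSet c xs, νm ≤ ν i := by
    have : ∀ᶠ t in 𝓝[>] (0 : ℝ), 0 < t ∧ ∀ i ∈ activeSet c xs, t ≤ ν i := by
      refine (eventually_mem_nhdsWithin).and ((Finset.eventually_all _).2 fun i hi => ?_)
      exact nhdsWithin_le_nhds (eventually_le_nhds (h.active_pos i hi))
    exact this.exists
  have hγ : ∃ γ : ℝ, 0 < γ ∧ ∀ i, i ∉ activeSet c xs → γ < c i xs := by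
    have : ∀ᶠ t in 𝓝[>] (0 : ℝ), 0 < t ∧ ∀ i, i ∉ activeSet c xs → t < c i xs := by
      refine (eventually_mem_nhdsWithin).and (eventually_all.2 fun i => ?_)
      by_cases hi : i ∈ activeSet c xs
      · simp [hi]
      · have h0 : 0 < c i xs :=
          lt_of_le_of_ne (h.feasible i) fun h0 => hi (mem_activeSet.2 h0.symm)
        filter_upwards [nhdsWithin_le_nhds (eventually_lt_nhds h0)] with t ht _ using ht
    exact this.exists
  obtain ⟨νm, hνm, hν⟩ := hνm
  obtain ⟨γ, hγ, hγc⟩ := hγ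
  have hev₄ : ∀ᶠ x in 𝓝 xs, ∀ i, i ∉ activeSet c xs → γ ≤ c i x := by
    refine eventually_all.2 fun i => ?_
    by_cases hi : i ∈ activeSet c xs
    · simp [hi]
    · filter_upwards [(hc i).continuous.continuousAt.eventually
        (eventually_gt_nhds (hγc i hi))] with x hx _ using hx.le
  have hev₅ : ∃ B₁ : ℝ, ∀ᶠ x in 𝓝 xs, ∀ i, ‖gradient (c i) x‖ ≤ B₁ := by
    refine ⟨∑ i, (‖gradient (c i) xs‖ + 1), eventually_all.2 fun i => ?_⟩
    have h1 : ContinuousAt (fun x => ‖gradient (c i) x‖) xs :=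
      (continuous_gradient (hc i)).norm.continuousAt
    filter_upwards [h1.eventually (eventually_lt_nhds (lt_add_one _))] with x hx
    exact hx.le.trans (Finset.single_le_sum (f := fun i => ‖gradient (c i) xs‖ + 1)
      (fun j _ => by positivity) (Finset.mem_univ i))
  obtain ⟨B₁, hev₅⟩ := hev₅
  obtain ⟨B₂, hB₂, hev₆⟩ :=
    (hf.differentiable two_ne_zero xs).hasFDerivAt.isBigO_sub.exists_nonneg
  have hres : DifferentiableAt ℝ (fun x => gradient f x - ∑ i, ν i • gradient (c i) x) xs := by
    have h1 := (contDiffAt_gradient (hf.contDiffAt (x := xs))).differentiableAt one_ne_zero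
    have h2 := fun i => (contDiffAt_gradient ((hc i).contDiffAt (x := xs))).differentiableAt
      one_ne_zero
    fun_prop
  obtain ⟨K, hK, hev₇⟩ := hres.hasFDerivAt.isBigO_sub.exists_nonneg
  have hall := (hev₁.and hev₂).and ((hev₃.and hev₄).and (hev₅.and (hev₆.bound.and hev₇.bound)))
  obtain ⟨r₀, hr₀, hball⟩ := Metric.nhds_basis_closedBall.eventually_iff.1 hall
  -- The second entry gives `radius_le`; K + 1 replaces K because K may be 0.
  set r := min r₀ (α * νm / 4 / (K + 1)) with hr
  have hsub : ∀ x ∈ Metric.closedBall xs r, x ∈ Metric.closedBall xs r₀ := fun x hx =>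
    Metric.closedBall_subset_closedBall (min_le_left _ _) hx
  refine ⟨r, min κ₁ κ₂, γ, max B₁ B₂, α, K, νm, ?_⟩
  constructor
  · positivity
  · positivity
  · exact hγ
  · exact hB₂.trans (le_max_right _ _)
  · exact hα
  · exact hK
  · exact hνm
  · exact hν
  · intro x hx
    exact (mul_le_mul_of_nonneg_right (min_le_right _ _) (sq_nonneg _)).trans
      (hball (hsub x hx)).1.2
  · intro x hx u
    exact (mul_le_mul_of_nonneg_right (min_le_left _ _) (sq_nonneg _)).trans
      ((hball (hsub x hx)).1.1 u)
  · exact fun x hx => (hball (hsub x hx)).2.1.2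
  · exact fun x hx i => ((hball (hsub x hx)).2.2.1 i).trans (le_max_left _ _)
  · intro x hx
    exact ((hball (hsub x hx)).2.2.2.1).trans
      (mul_le_mul_of_nonneg_right (le_max_right _ _) (norm_nonneg _))
  · exact fun x hx => (hball (hsub x hx)).2.1.1
  · intro x hx
    have h1 := (hball (hsub x hx)).2.2.2.2
    rw [h.stationary, sub_self, sub_zero] at h1
    exact h1
  · have h1 : r * (K + 1) ≤ α * νm / 4 := (le_div_iff₀ (by positivity)).1 (min_le_right _ _)
    have h2 : 0 < r := by positivity
    nlinarith

end LocalGeometry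

end ExteriorDistance

end

noncomputable section

namespace ExteriorDistance

open Set Filter Topology

/-! ### Convexity, derivatives and minimizers of the EDF. -/

section EDF

variable {n m : ℕ} {f : EuclideanSpace ℝ (Fin n) → ℝ}
  {c : Fin m → EuclideanSpace ℝ (Fin n) → ℝ}
  {xs y : EuclideanSpace ℝ (Fin n)} {ν l : Fin m → ℝ} {k : ℝ}

theorem isOpen_edfDomain (hf : Continuous f) (hc : ∀ i, Continuous (c i)) :
    IsOpen (edfDomain f c y k) := by
  have h : edfDomain f c y k = {x | f x < f y} ∩ ⋂ i, {x | 0 < k * c i x + 1} := by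
    ext x; simp [edfDomain]
  rw [h]
  exact (isOpen_lt hf continuous_const).inter
    (isOpen_iInter_of_finite fun i => isOpen_lt continuous_const (by have := hc i; fun_prop))

theorem concaveOn_scaledConstraint {g : EuclideanSpace ℝ (Fin n) → ℝ}
    (hg : ConcaveOn ℝ univ g) (hk : 0 ≤ k) : ConcaveOn ℝ univ fun x => k * g x + 1 :=
  (hg.smul hk).add_const 1

theorem convex_edfDomain (hfconv : ConvexOn ℝ univ f) (hcconc : ∀ i, ConcaveOn ℝ univ (c i))
    (hk : 0 ≤ k) : Convex ℝ (edfDomain f c y k) := by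
  have h : edfDomain f c y k = {x ∈ univ | f x < f y} ∩
      ⋂ i, {x ∈ univ | 0 < k * c i x + 1} := by
    ext x; simp [edfDomain]
  rw [h]
  exact (hfconv.convex_lt _).inter
    (convex_iInter fun i => (concaveOn_scaledConstraint (hcconc i) hk).convex_gt _)

theorem concaveOn_log_comp {g : EuclideanSpace ℝ (Fin n) → ℝ}
    {s : Set (EuclideanSpace ℝ (Fin n))} (hg : ConcaveOn ℝ s g) (hpos : ∀ x ∈ s, 0 < g x) :
    ConcaveOn ℝ s fun x => Real.log (g x) := by
  refine ⟨hg.1, fun x hx z hz a b ha hb hab => ?_⟩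
  have h1 := strictConcaveOn_log_Ioi.concaveOn.2 (hpos x hx) (hpos z hz) ha hb hab
  have h2 : 0 < a • g x + b • g z :=
    (convex_Ioi (0 : ℝ)) (hpos x hx) (hpos z hz) ha hb hab
  exact h1.trans (Real.log_le_log h2 (hg.2 hx hz ha hb hab))

theorem convexOn_edf (hfconv : ConvexOn ℝ univ f) (hcconc : ∀ i, ConcaveOn ℝ univ (c i))
    (hk : 0 < k) (hl : ∀ i, 0 ≤ l i) :
    ConvexOn ℝ (edfDomain f c y k) (edf f c y l k) := by
  have hD := convex_edfDomain (y := y) hfconv hcconc hk.le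
  have h1 : ConvexOn ℝ (edfDomain f c y k) fun x => -Real.log (f y - f x) := by
    refine (concaveOn_log_comp ?_ fun x hx => sub_pos.2 hx.1).neg
    exact (concaveOn_const (f y) hD).sub (hfconv.subset (subset_univ _) hD)
  have h2 : ∀ i, ConcaveOn ℝ (edfDomain f c y k) fun x => Real.log (k * c i x + 1) := fun i =>
    concaveOn_log_comp ((concaveOn_scaledConstraint (hcconc i) hk.le).subset (subset_univ _) hD)
      fun x hx => hx.2 i
  refine ⟨hD, fun x hx z hz a b ha hb hab => ?_⟩
  have h3 := h1.2 hx hz ha hb hab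
  have h4 : a * ∑ i, l i * Real.log (k * c i x + 1) + b * ∑ i, l i * Real.log (k * c i z + 1)
      ≤ ∑ i, l i * Real.log (k * c i (a • x + b • z) + 1) := by
    rw [Finset.mul_sum, Finset.mul_sum, ← Finset.sum_add_distrib]
    refine Finset.sum_le_sum fun i _ => ?_
    have := mul_le_mul_of_nonneg_left ((h2 i).2 hx hz ha hb hab) (hl i)
    simp only [smul_eq_mul] at this
    linarith
  have h5 := mul_le_mul_of_nonneg_left h4 (inv_pos.2 hk).le
  simp only [edf, transformedObjective, smul_eq_mul] at h3 ⊢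
  linarith

theorem edf_eq_separable : edf f c y l k = fun x =>
    (fun v => -Real.log (f y - v)) (f x)
      + ∑ i, (fun v => -(k⁻¹ * l i) * Real.log (k * v + 1)) (c i x) := by
  ext x
  simp only [edf, transformedObjective, sub_eq_add_neg, Finset.mul_sum, ← Finset.sum_neg_distrib]
  congr 1
  exact Finset.sum_congr rfl fun i _ => by ring

theorem hasDerivAt_neg_log_sub {t v : ℝ} (hv : v < t) :
    HasDerivAt (fun v => -Real.log (t - v)) (t - v)⁻¹ v := by
  have h := (((hasDerivAt_id v).const_sub t).log (sub_pos.2 hv).ne').neg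
  refine h.congr_deriv ?_
  simp [neg_div]

theorem hasDerivAt_inv_sub {t v : ℝ} (hv : v < t) :
    HasDerivAt (fun v => (t - v)⁻¹) ((t - v) ^ 2)⁻¹ v := by
  have h := ((hasDerivAt_id v).const_sub t).inv (sub_pos.2 hv).ne'
  refine h.congr_deriv ?_
  simp

theorem hasDerivAt_log_scaled (hk : k ≠ 0) {b v : ℝ} (hv : 0 < k * v + 1) :
    HasDerivAt (fun v => -(k⁻¹ * b) * Real.log (k * v + 1)) (-(b * (k * v + 1)⁻¹)) v := by
  have h := ((((hasDerivAt_id v).const_mul k).add_const 1).log hv.ne').const_mul (-(k⁻¹ * b))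
  refine h.congr_deriv ?_
  have hv' := hv.ne'
  simp only [id, mul_one]
  field_simp

theorem hasDerivAt_inv_scaled {b v : ℝ} (hv : 0 < k * v + 1) :
    HasDerivAt (fun v => -(b * (k * v + 1)⁻¹)) (k * b * ((k * v + 1) ^ 2)⁻¹) v := by
  have h := ((((hasDerivAt_id v).const_mul k).add_const 1).inv hv.ne').const_mul b |>.neg
  refine h.congr_deriv ?_
  simp only [id, mul_one]
  field_simp

/-- The chain rule turns each multiplier into its update. A critical point of the EDF is therefore a
critical point of the Lagrangian with the updated multipliers. -/
theorem hasGradientAt_edf (hf : ContDiff ℝ 2 f) (hc : ∀ i, ContDiff ℝ 2 (c i)) (hk : k ≠ 0)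
    {x : EuclideanSpace ℝ (Fin n)} (hx : x ∈ edfDomain f c y k) :
    HasGradientAt (edf f c y l k)
      ((f y - f x)⁻¹ • gradient f x - ∑ i, multiplierUpdate c l k x i • gradient (c i) x) x := by
  have h := hasGradientAt_separable (hf.differentiable two_ne_zero x)
    (fun i => (hc i).differentiable two_ne_zero x) (hasDerivAt_neg_log_sub hx.1)
    (fun i => hasDerivAt_log_scaled (b := l i) hk (hx.2 i))
  rw [edf_eq_separable]
  convert h using 1
  rw [sub_eq_add_neg, ← Finset.sum_neg_distrib]
  simp [multiplierUpdate]

theorem contDiffAt_edf (hf : ContDiff ℝ 2 f) (hc : ∀ i, ContDiff ℝ 2 (c i))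
    {x : EuclideanSpace ℝ (Fin n)} (hx : x ∈ edfDomain f c y k) :
    ContDiffAt ℝ 2 (edf f c y l k) x := by
  unfold edf transformedObjective
  refine ContDiffAt.sub ?_ (contDiffAt_const.mul (ContDiffAt.sum fun i _ => ?_))
  · exact ((contDiffAt_const.sub hf.contDiffAt).log (sub_pos.2 hx.1).ne').neg
  · exact contDiffAt_const.mul
      (((contDiffAt_const.mul (hc i).contDiffAt).add contDiffAt_const).log (hx.2 i).ne')

theorem hessian_edf_inner (hf : ContDiff ℝ 2 f) (hc : ∀ i, ContDiff ℝ 2 (c i)) (hk : k ≠ 0)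
    {x : EuclideanSpace ℝ (Fin n)} (hx : x ∈ edfDomain f c y k)
    (u : EuclideanSpace ℝ (Fin n)) :
    inner ℝ (hessian (edf f c y l k) x u) u
      = ((f y - f x)⁻¹ * inner ℝ (hessian f x u) u
          + ((f y - f x) ^ 2)⁻¹ * inner ℝ (gradient f x) u ^ 2)
        + ∑ i, (-multiplierUpdate c l k x i * inner ℝ (hessian (c i) x u) u
          + k * l i * ((k * c i x + 1) ^ 2)⁻¹ * inner ℝ (gradient (c i) x) u ^ 2) := by
  rw [edf_eq_separable]
  exact hessian_separable_inner hf hc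
    ((eventually_lt_nhds hx.1).mono fun v hv => hasDerivAt_neg_log_sub hv)
    (fun i => (continuousAt_id.const_mul k |>.add_const 1 |>.eventually
      (eventually_gt_nhds (hx.2 i))).mono fun v hv => hasDerivAt_log_scaled hk hv)
    (hasDerivAt_inv_sub hx.1) (fun i => hasDerivAt_inv_scaled (hx.2 i)) u

variable {r κ γ B α K νm : ℝ}

/-- The exterior distance function is strongly convex near each point of its domain at which
the local estimates hold. -/
theorem LocalEstimates.exists_strongConvexOn_edf
    (H : LocalEstimates f c xs ν r κ γ B α K νm)
    (hreg : RegularKKT f c xs ν)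
    (hf : ContDiff ℝ 2 f) (hc : ∀ i, ContDiff ℝ 2 (c i))
    (hfconv : ConvexOn ℝ univ f) (hcconc : ∀ i, ConcaveOn ℝ univ (c i))
    (hk : 0 < k) (hl : ∀ i, 0 ≤ l i) (hlact : ∀ i ∈ activeSet c xs, 0 < l i)
    {x : EuclideanSpace ℝ (Fin n)} (hx : x ∈ edfDomain f c y k)
    (hxr : x ∈ Metric.closedBall xs r) :
    ∃ ε : ℝ, 0 < ε ∧ Metric.ball x ε ⊆ edfDomain f c y k ∧ ∃ ρ : ℝ, 0 < ρ ∧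
      StrongConvexOn (Metric.ball x ε) ρ (edf f c y l k) := by
  have ha : 0 < (f y - f x)⁻¹ := inv_pos.2 (sub_pos.2 hx.1)
  -- With p this small, p times the form in `posdef` is dominated term by term by the EDF Hessian.
  -- The signs of the individual Hessians come from convexity of f and concavity of the constraints.
  obtain ⟨p, hp, hpa, hpact⟩ : ∃ p : ℝ, 0 < p ∧ p ≤ (f y - f x)⁻¹ ∧ ∀ i ∈ activeSet c xs,
      p * ν i ≤ multiplierUpdate c l k x i ∧ p ≤ k * l i * ((k * c i x + 1) ^ 2)⁻¹ := by
    have : ∀ᶠ p in 𝓝[>] (0 : ℝ), 0 < p ∧ p ≤ (f y - f x)⁻¹ ∧ ∀ i ∈ activeSet c xs,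
      p * ν i ≤ multiplierUpdate c l k x i ∧ p ≤ k * l i * ((k * c i x + 1) ^ 2)⁻¹ := by
      refine eventually_mem_nhdsWithin.and (Eventually.filter_mono nhdsWithin_le_nhds
        ((eventually_le_nhds ha).and ((Finset.eventually_all _).2 fun i hi =>
          Eventually.and ?_ (eventually_le_nhds ?_))))
      · have h1 : ContinuousAt (fun p : ℝ => p * ν i) 0 := by fun_prop
        refine h1.eventually (eventually_le_nhds ?_)
        simp only [zero_mul]
        exact mul_pos (hlact i hi) (inv_pos.2 (hx.2 i))
      · have := hlact i hi
        have := hx.2 i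
        positivity
    exact this.exists
  have hPD : ∀ u, p * κ * ‖u‖ ^ 2 ≤ inner ℝ (hessian (edf f c y l k) x u) u := by
    intro u
    rw [hessian_edf_inner hf hc hk.ne' hx]
    have h1 := mul_le_mul_of_nonneg_left (H.posdef x hxr u) hp.le
    have h2 := hessian_inner_nonneg_of_convexOn hf hfconv x u
    have h3 : ∀ i, inner ℝ (hessian (c i) x u) u ≤ 0 := fun i =>
      hessian_inner_nonpos_of_concaveOn (hc i) (hcconc i) x u
    have h4 : p * inner ℝ (hessian f x u) u ≤ (f y - f x)⁻¹ * inner ℝ (hessian f x u) u :=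
      mul_le_mul_of_nonneg_right hpa h2
    have h5 : 0 ≤ ((f y - f x) ^ 2)⁻¹ * inner ℝ (gradient f x) u ^ 2 := by positivity
    have h6 : p * (-∑ i, ν i * inner ℝ (hessian (c i) x u) u
        + ∑ i ∈ activeSet c xs, inner ℝ (gradient (c i) x) u ^ 2)
        ≤ ∑ i, (-multiplierUpdate c l k x i * inner ℝ (hessian (c i) x u) u
          + k * l i * ((k * c i x + 1) ^ 2)⁻¹ * inner ℝ (gradient (c i) x) u ^ 2) := by
      have h7 : ∑ i ∈ activeSet c xs, inner ℝ (gradient (c i) x) u ^ 2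
          = ∑ i, if i ∈ activeSet c xs then inner ℝ (gradient (c i) x) u ^ 2 else 0 := by
        simp [Finset.sum_ite_mem]
      rw [h7, ← Finset.sum_neg_distrib, ← Finset.sum_add_distrib, Finset.mul_sum]
      refine Finset.sum_le_sum fun i _ => ?_
      have h8 := h3 i
      by_cases hi : i ∈ activeSet c xs
      · rw [if_pos hi]
        have h9 := mul_le_mul_of_nonneg_right (hpact i hi).1 (neg_nonneg.2 h8)
        have h10 := mul_le_mul_of_nonneg_right (hpact i hi).2
          (sq_nonneg (inner ℝ (gradient (c i) x) u))
        linarith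
      · rw [if_neg hi, hreg.passive_eq i hi]
        have h9 : 0 ≤ multiplierUpdate c l k x i := mul_nonneg (hl i) (inv_pos.2 (hx.2 i)).le
        have h10 : 0 ≤ k * l i * ((k * c i x + 1) ^ 2)⁻¹ * inner ℝ (gradient (c i) x) u ^ 2 := by
          have := hl i
          positivity
        nlinarith
    linarith
  obtain ⟨ε₁, hε₁, hstrong⟩ := exists_strongConvexOn_ball (contDiffAt_edf hf hc hx)
    (mul_pos hp H.κ_pos) hPD
  obtain ⟨ε₂, hε₂, hsub⟩ := Metric.isOpen_iff.1
    (isOpen_edfDomain (y := y) (k := k) hf.continuous fun i => (hc i).continuous) x hx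
  exact ⟨min ε₁ ε₂, lt_min hε₁ hε₂,
    (Metric.ball_subset_ball (min_le_right _ _)).trans hsub, p * κ / 2,
    half_pos (mul_pos hp H.κ_pos), hstrong _ (min_le_left _ _)⟩

/-- A minimizer of a convex function near which the function is strongly convex is unique. -/
theorem eq_of_isMinOn_of_strongConvexOn {g : EuclideanSpace ℝ (Fin n) → ℝ}
    {s : Set (EuclideanSpace ℝ (Fin n))} (hg : ConvexOn ℝ s g)
    {x z : EuclideanSpace ℝ (Fin n)} (hx : x ∈ s) (hz : z ∈ s)
    (hxmin : IsMinOn g s x) (hzmin : IsMinOn g s z) {ε ρ : ℝ} (hε : 0 < ε) (hρ : 0 < ρ)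
    (hsub : Metric.ball x ε ⊆ s) (hstrong : StrongConvexOn (Metric.ball x ε) ρ g) : z = x := by
  by_contra hne
  have hd : 0 < ‖z - x‖ := norm_pos_iff.2 (sub_ne_zero.2 hne)
  -- The point w at parameter t on the segment from x to z lies in the ball and, by convexity, its
  -- value does not exceed the minimum. Strong convexity puts the midpoint of w and x strictly below
  -- the minimum.
  obtain ⟨t, ht0, ht1, htε⟩ : ∃ t : ℝ, 0 < t ∧ t ≤ 1 ∧ t * ‖z - x‖ < ε := by
    refine ⟨min 1 (ε / 2 / ‖z - x‖), by positivity, min_le_left _ _, ?_⟩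
    calc min 1 (ε / 2 / ‖z - x‖) * ‖z - x‖ ≤ ε / 2 / ‖z - x‖ * ‖z - x‖ :=
          mul_le_mul_of_nonneg_right (min_le_right _ _) hd.le
      _ = ε / 2 := by field_simp
      _ < ε := half_lt_self hε
  have hgz : g z = g x := le_antisymm (hzmin hx) (hxmin hz)
  have hw := hg.2 hx hz (sub_nonneg.2 ht1) ht0.le (by ring)
  set w := (1 - t) • x + t • z with hwdef
  have hwx : w - x = t • (z - x) := by rw [hwdef]; module
  have hwnorm : ‖w - x‖ = t * ‖z - x‖ := by rw [hwx, norm_smul, Real.norm_of_nonneg ht0.le]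
  have hwball : w ∈ Metric.ball x ε := by rw [mem_ball_iff_norm, hwnorm]; exact htε
  have h1 := hstrong.2 hwball (Metric.mem_ball_self hε)
    (by norm_num : (0 : ℝ) ≤ 1 / 2) (by norm_num : (0 : ℝ) ≤ 1 / 2) (by norm_num)
  have h2 : g x ≤ g ((1 / 2 : ℝ) • w + (1 / 2 : ℝ) • x) := hxmin (hsub
    ((convex_ball x ε) hwball (Metric.mem_ball_self hε)
      (by norm_num : (0 : ℝ) ≤ 1 / 2) (by norm_num : (0 : ℝ) ≤ 1 / 2) (by norm_num)))
  simp only [smul_eq_mul, hgz] at hw h1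
  have h3 : 0 < ‖w - x‖ ^ 2 := by rw [hwnorm]; positivity
  nlinarith [mul_pos hρ h3]

/-- The exterior distance function attains its minimum on a closed ball about the solution. -/
theorem exists_isMinOn_edf_closedBall (hf : Continuous f) (hc : ∀ i, Continuous (c i))
    (hk : 0 < k) (hl : ∀ i, 0 ≤ l i) (hr : 0 ≤ r) (hxs : xs ∈ edfDomain f c y k)
    (hlact : ∀ i, l i = 0 → ∀ x ∈ Metric.closedBall xs r, 0 ≤ c i x) :
    ∃ x ∈ Metric.closedBall xs r ∩ edfDomain f c y k,
      IsMinOn (edf f c y l k) (Metric.closedBall xs r ∩ edfDomain f c y k) x := by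
  -- ψ equals exp(-EDF) on the domain but is continuous everywhere, so it attains a maximum on the
  -- compact closed version S of the constraints. Positivity of the maximum puts it back into the
  -- open domain.
  set ψ : EuclideanSpace ℝ (Fin n) → ℝ :=
    fun x => (f y - f x) * ∏ i, (k * c i x + 1) ^ (k⁻¹ * l i) with hψ
  have hexp : ∀ i, 0 ≤ k⁻¹ * l i := fun i => mul_nonneg (inv_pos.2 hk).le (hl i)
  set S : Set (EuclideanSpace ℝ (Fin n)) :=
    Metric.closedBall xs r ∩ {x | f x ≤ f y ∧ ∀ i, 0 ≤ k * c i x + 1} with hS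
  have hScomp : IsCompact S := by
    refine (isCompact_closedBall xs r).inter_right ?_
    have h : {x | f x ≤ f y ∧ ∀ i, 0 ≤ k * c i x + 1}
        = {x | f x ≤ f y} ∩ ⋂ i, {x | 0 ≤ k * c i x + 1} := by
      ext x; simp
    rw [h]
    exact (isClosed_le hf continuous_const).inter
      (isClosed_iInter fun i => isClosed_le continuous_const (by have := hc i; fun_prop))
  have hψc : Continuous ψ := by
    refine (continuous_const.sub hf).mul (continuous_finsetProd _ fun i _ => ?_)
    exact Continuous.rpow_const (by have := hc i; fun_prop) fun x => Or.inr (hexp i)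
  have hDS : Metric.closedBall xs r ∩ edfDomain f c y k ⊆ S := fun x hx =>
    ⟨hx.1, hx.2.1.le, fun i => (hx.2.2 i).le⟩
  have hψpos : ∀ x ∈ edfDomain f c y k, 0 < ψ x := fun x hx =>
    mul_pos (sub_pos.2 hx.1) (Finset.prod_pos fun i _ => Real.rpow_pos_of_pos (hx.2 i) _)
  have hlog : ∀ x ∈ edfDomain f c y k, edf f c y l k x = -Real.log (ψ x) := by
    intro x hx
    have h1 : ∀ i ∈ Finset.univ, (k * c i x + 1) ^ (k⁻¹ * l i) ≠ 0 := fun i _ =>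
      (Real.rpow_pos_of_pos (hx.2 i) _).ne'
    rw [hψ, Real.log_mul (sub_pos.2 hx.1).ne' (Finset.prod_ne_zero_iff.2 h1),
      Real.log_prod h1, edf, transformedObjective, Finset.mul_sum, neg_add, sub_eq_add_neg]
    congr 2
    exact Finset.sum_congr rfl fun i _ => by rw [Real.log_rpow (hx.2 i)]; ring
  have hxsr : xs ∈ Metric.closedBall xs r := Metric.mem_closedBall_self hr
  obtain ⟨x, hx, hmax⟩ := hScomp.exists_isMaxOn ⟨xs, hDS ⟨hxsr, hxs⟩⟩ hψc.continuousOn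
  have hxpos : 0 < ψ x := (hψpos xs hxs).trans_le (hmax (hDS ⟨hxsr, hxs⟩))
  have hxD : x ∈ edfDomain f c y k := by
    constructor
    · refine lt_of_le_of_ne hx.2.1 fun h => ?_
      simp [hψ, h] at hxpos
    · intro i
      rcases (hx.2.2 i).eq_or_lt with h | h
      · exfalso
        -- A zero multiplier gives the factor 0 ^ 0 = 1, so ψ need not vanish there; this boundary
        -- is excluded by `hlact` instead.
        by_cases hli : l i = 0
        · have := hlact i hli x hx.1
          nlinarith
        · have h0 : ∏ i, (k * c i x + 1) ^ (k⁻¹ * l i) = 0 :=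
            Finset.prod_eq_zero (Finset.mem_univ i) (by
              rw [← h]; exact Real.zero_rpow (mul_ne_zero (inv_ne_zero hk.ne') hli))
          simp [hψ, h0] at hxpos
      · exact h
  refine ⟨x, ⟨hx.1, hxD⟩, fun z hz => ?_⟩
  change edf f c y l k x ≤ edf f c y l k z
  rw [hlog x hxD, hlog z hz.2, neg_le_neg_iff]
  exact Real.log_le_log (hψpos z hz.2) (hmax (hDS hz))

/-- If the exterior distance function increases radially along the boundary of a closed ball
about the solution, it has a global minimizer in the interior of that ball. -/
theorem exists_isEDFMinimizer_of_radial (hf : ContDiff ℝ 2 f) (hc : ∀ i, ContDiff ℝ 2 (c i))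
    (hfconv : ConvexOn ℝ univ f) (hcconc : ∀ i, ConcaveOn ℝ univ (c i))
    (hk : 0 < k) (hl : ∀ i, 0 ≤ l i) (hr : 0 < r) (hxs : xs ∈ edfDomain f c y k)
    (hlact : ∀ i, l i = 0 → ∀ x ∈ Metric.closedBall xs r, 0 ≤ c i x)
    (hrad : ∀ x ∈ Metric.sphere xs r, x ∈ edfDomain f c y k →
      0 < inner ℝ (gradient (edf f c y l k) x) (x - xs)) :
    ∃ x ∈ Metric.closedBall xs r, IsEDFMinimizer f c y l k x ∧
      gradient (edf f c y l k) x = 0 := by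
  obtain ⟨x, ⟨hxr, hxD⟩, hmin⟩ := exists_isMinOn_edf_closedBall hf.continuous
    (fun i => (hc i).continuous) hk hl hr.le hxs hlact
  have hconv := convexOn_edf (y := y) hfconv hcconc hk hl
  have hgrad := hasGradientAt_edf (l := l) hf hc hk.ne' hxD
  have hgrad' : HasGradientAt (edf f c y l k) (gradient (edf f c y l k) x) x :=
    hgrad.differentiableAt.hasGradientAt
  have hball : x ∈ Metric.ball xs r := by
    rw [Metric.mem_ball]
    refine lt_of_le_of_ne hxr fun hsph => ?_
    have h1 := hrad x hsph hxD
    have hcv : Convex ℝ (Metric.closedBall xs r ∩ edfDomain f c y k) :=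
      (convex_closedBall xs r).inter hconv.1
    -- A minimizer on the sphere would have a nonnegative derivative towards the center of the ball,
    -- contrary to `hrad`.
    have h2 : xs - x ∈ posTangentConeAt (Metric.closedBall xs r ∩ edfDomain f c y k) x :=
      sub_mem_posTangentConeAt_of_segment_subset
        (hcv.segment_subset ⟨hxr, hxD⟩ ⟨Metric.mem_closedBall_self hr.le, hxs⟩)
    have h3 := hmin.localize.hasFDerivWithinAt_nonneg
      hgrad'.hasFDerivAt.hasFDerivWithinAt h2
    rw [InnerProductSpace.toDual_apply_apply, ← neg_sub, inner_neg_right] at h3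
    linarith
  have hlocal : IsLocalMin (edf f c y l k) x := by
    have hopen : Metric.closedBall xs r ∩ edfDomain f c y k ∈ 𝓝 x :=
      inter_mem (Metric.closedBall_mem_nhds_of_mem hball)
        ((isOpen_edfDomain hf.continuous fun i => (hc i).continuous).mem_nhds hxD)
    exact hmin.isLocalMin hopen
  refine ⟨x, hxr, ⟨hxD, IsMinOn.of_isLocalMinOn_of_convexOn hxD (hlocal.on _) hconv⟩, ?_⟩
  simp [gradient, hlocal.fderiv_eq_zero]

end EDF

end ExteriorDistance

end

noncomputable section

namespace ExteriorDistance

open Set Filter Topology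

/-! ### Energy inequality, thresholds and the linear error bound. -/

section ErrorBounds

variable {n m : ℕ} {f : EuclideanSpace ℝ (Fin n) → ℝ}
  {c : Fin m → EuclideanSpace ℝ (Fin n) → ℝ}
  {xs y x : EuclideanSpace ℝ (Fin n)} {ν l : Fin m → ℝ} {k T : ℝ}
  {r κ γ B α K νm τ₀ δ k₀ : ℝ}

/-- With z = kv + 1 the product is (sz - b)(z - 1)/(kz). The numerator equals b(z - 1)² + (s - b)z(z
- 1), and also s(z - 1)² + (s - b)(z - 1). The first form settles b ≤ s, the second s ≤ b. The bound
holds for all v in the domain, however large. -/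
theorem neg_le_multiplier_defect_mul {s b v : ℝ} (hk : 0 < k) (hs : 0 ≤ s) (hb : 0 ≤ b)
    (hv : 0 < k * v + 1) (hT : |b - s| ≤ T * k) : -T ≤ (s - b * (k * v + 1)⁻¹) * v := by
  obtain ⟨z, hz⟩ : ∃ z, z = k * v + 1 := ⟨_, rfl⟩
  have hv' : v = (z - 1) / k := by rw [hz]; field_simp; ring
  rw [← hz] at hv ⊢
  obtain ⟨h1, h2⟩ := abs_le.1 hT
  have key : -(T * k) * z ≤ (s * z - b) * (z - 1) := by
    rcases le_total b s with h | h
    · nlinarith [mul_nonneg hb (sq_nonneg (z - 1)), mul_nonneg (sub_nonneg.2 h) (sq_nonneg z)]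
    · nlinarith [mul_nonneg hs (sq_nonneg (z - 1)), mul_nonneg (sub_nonneg.2 h) hv.le]
  have h3 : (s - b * z⁻¹) * v = (s * z - b) * (z - 1) / (k * z) := by
    rw [hv']; field_simp
  rw [h3, le_div_iff₀ (by positivity)]
  linarith

/-- Here Δv = Δt/L - εΔ²/L. The negative term absorbs the Δ² part of τv²/2, since τε ≤ L. It is
applied with L the updated multiplier, Δ its error, ε = 1/k and v the constraint value. -/
theorem quadratic_complementarity_le {τ ε L t Δ v : ℝ} (hτ : 0 ≤ τ) (hε : 0 ≤ ε) (hL : 0 < L)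
    (hv : L * v = t - ε * Δ) (hτε : τ * ε ≤ L) :
    1 / 2 * τ * v ^ 2 + Δ * v ≤ τ * t ^ 2 / L ^ 2 + Δ * t / L := by
  have h1 : v = (t - ε * Δ) / L := by rw [← hv]; field_simp
  have h2 : 1 / 2 * τ * v ^ 2 + Δ * v
      = (1 / 2 * τ * (t - ε * Δ) ^ 2 + Δ * L * (t - ε * Δ)) / L ^ 2 := by
    rw [h1]; field_simp
  have h3 : τ * t ^ 2 / L ^ 2 + Δ * t / L = (τ * t ^ 2 + Δ * t * L) / L ^ 2 := by
    field_simp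
  rw [h2, h3]
  refine div_le_div_of_nonneg_right ?_ (by positivity)
  have h4 : 0 ≤ (L - τ * ε) * (ε * Δ ^ 2) :=
    mul_nonneg (sub_nonneg.2 hτε) (mul_nonneg hε (sq_nonneg _))
  nlinarith [mul_nonneg hτ (sq_nonneg (t + ε * Δ))]

theorem multiplierUpdate_nonneg (hl : ∀ i, 0 ≤ l i) (hx : x ∈ edfDomain f c y k) (i : Fin m) :
    0 ≤ multiplierUpdate c l k x i :=
  mul_nonneg (hl i) (inv_pos.2 (hx.2 i)).le

theorem LocalEstimates.multiplierUpdate_passive_le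
    (H : LocalEstimates f c xs ν r κ γ B α K νm) (hk : 0 < k) (hl : ∀ i, 0 ≤ l i)
    (hxr : x ∈ Metric.closedBall xs r)
    {i : Fin m} (hi : i ∉ activeSet c xs) (hT : l i ≤ T * k) :
    multiplierUpdate c l k x i ≤ T / γ := by
  have hγ := H.γ_pos
  have h1 := H.passive x hxr i hi
  have h2 : k * γ ≤ k * c i x + 1 := by nlinarith
  have h3 : 0 ≤ T * k := (hl i).trans hT
  unfold multiplierUpdate
  calc l i * (k * c i x + 1)⁻¹ ≤ T * k * (k * γ)⁻¹ := by
        refine mul_le_mul hT (inv_anti₀ (by positivity) h2) ?_ h3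
        exact inv_nonneg.2 (le_trans (by positivity) h2)
    _ = T / γ := by field_simp

theorem RegularKKT.sum_multiplier_mul (hreg : RegularKKT f c xs ν) (x) :
    ∑ i, ν i * c i x = ∑ i ∈ activeSet c xs, ν i * c i x := by
  symm
  refine Finset.sum_subset (Finset.subset_univ _) fun i _ hi => ?_
  rw [hreg.passive_eq i hi, zero_mul]

/-- Monotonicity estimate for the gradient of the exterior distance function. -/
theorem LocalEstimates.energy_le
    (H : LocalEstimates f c xs ν r κ γ B α K νm) (hreg : RegularKKT f c xs ν)
    (hf : ContDiff ℝ 2 f) (hc : ∀ i, ContDiff ℝ 2 (c i))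
    (hfconv : ConvexOn ℝ univ f) (hcconc : ∀ i, ConcaveOn ℝ univ (c i))
    (hy : f xs < f y) (hk : 0 < k) (hl : ∀ i, 0 ≤ l i)
    (hx : x ∈ edfDomain f c y k) (hxr : x ∈ Metric.closedBall xs r) (hT0 : 0 ≤ T)
    (hT : ∀ i, i ∉ activeSet c xs → l i ≤ T * k) :
    (f y - f xs)⁻¹ * (f x - f xs - ∑ i, ν i * c i x)
      + (f x - f xs) ^ 2 / ((f y - f x) * (f y - f xs))
      + ∑ i ∈ activeSet c xs,
        ((f y - f xs)⁻¹ * ν i - multiplierUpdate c l k x i) * c i x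
      - m * (T / γ * (B * ‖x - xs‖))
      ≤ inner ℝ (gradient (edf f c y l k) x) (x - xs) := by
  have hσ : 0 < f y - f xs := sub_pos.2 hy
  have ha : 0 < f y - f x := sub_pos.2 hx.1
  rw [(hasGradientAt_edf (l := l) hf hc hk.ne' hx).gradient, inner_sub_left, inner_smul_left,
    sum_inner]
  simp only [inner_smul_left, conj_trivial]
  have hneg : xs - x = -(x - xs) := by abel
  have h1 := gradient_inequality hfconv (hf.differentiable two_ne_zero x) xs
  rw [hneg, inner_neg_right] at h1
  have h2 : (f y - f x)⁻¹ * (f x - f xs)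
      ≤ (f y - f x)⁻¹ * inner ℝ (gradient f x) (x - xs) :=
    mul_le_mul_of_nonneg_left (by linarith) (inv_pos.2 ha).le
  -- Replacing the weight at x by the one at `xs` leaves a nonnegative square, which later controls
  -- the gap f(y) - f(x).
  have h3 : (f y - f x)⁻¹ * (f x - f xs) = (f y - f xs)⁻¹ * (f x - f xs)
      + (f x - f xs) ^ 2 / ((f y - f x) * (f y - f xs)) := by
    field_simp
    ring
  have h4 : ∑ i, multiplierUpdate c l k x i * inner ℝ (gradient (c i) x) (x - xs)
      ≤ ∑ i ∈ activeSet c xs, multiplierUpdate c l k x i * c i x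
        + m * (T / γ * (B * ‖x - xs‖)) := by
    have h5 : ∑ i ∈ activeSet c xs, multiplierUpdate c l k x i * c i x
        = ∑ i, if i ∈ activeSet c xs then multiplierUpdate c l k x i * c i x else 0 := by
      simp [Finset.sum_ite_mem]
    have h6 : (m : ℝ) * (T / γ * (B * ‖x - xs‖)) = ∑ _i : Fin m, T / γ * (B * ‖x - xs‖) := by
      simp
    rw [h5, h6, ← Finset.sum_add_distrib]
    have hγ := H.γ_pos
    have hB := H.B_nonneg
    have h7 : 0 ≤ T / γ * (B * ‖x - xs‖) := by positivity
    refine Finset.sum_le_sum fun i _ => ?_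
    have h8 := multiplierUpdate_nonneg hl hx i
    -- For active i, concavity and c_i(xs) = 0 bound the directional term by c_i(x). For passive i,
    -- the updated multiplier is at most T/γ and a crude gradient bound is enough.
    by_cases hi : i ∈ activeSet c xs
    · rw [if_pos hi]
      have h9 := gradient_inequality_concave (hcconc i) ((hc i).differentiable two_ne_zero x) xs
      rw [hneg, inner_neg_right, mem_activeSet.1 hi] at h9
      have h10 := mul_le_mul_of_nonneg_left
        (show inner ℝ (gradient (c i) x) (x - xs) ≤ c i x by linarith) h8
      linarith
    · rw [if_neg hi, zero_add]
      have h9 : inner ℝ (gradient (c i) x) (x - xs) ≤ B * ‖x - xs‖ :=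
        (real_inner_le_norm _ _).trans
          (mul_le_mul_of_nonneg_right (H.gradient_le x hxr i) (norm_nonneg _))
      exact (mul_le_mul_of_nonneg_left h9 h8).trans (mul_le_mul_of_nonneg_right
        (H.multiplierUpdate_passive_le hk hl hxr hi (hT i hi)) (by positivity))
  have h11 : ∑ i ∈ activeSet c xs,
      ((f y - f xs)⁻¹ * ν i - multiplierUpdate c l k x i) * c i x
      = (f y - f xs)⁻¹ * ∑ i, ν i * c i x
        - ∑ i ∈ activeSet c xs, multiplierUpdate c l k x i * c i x := by
    rw [hreg.sum_multiplier_mul, Finset.mul_sum, ← Finset.sum_sub_distrib]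
    exact Finset.sum_congr rfl fun i _ => by ring
  rw [h11, mul_sub]
  linarith

/-- Smallness conditions on `δ` and largeness conditions on `k₀`, uniform in the center. -/
structure DualThresholds (m : ℕ) (r κ γ B α νm τ₀ δ k₀ : ℝ) : Prop where
  δ_pos : 0 < δ
  k₀_pos : 0 < k₀
  growth : δ * (m * (1 + B * r / γ)) < τ₀ * (κ * r ^ 2 / 2)
  -- η is a size that some active constraint must reach on the sphere when the Lagrangian excess is
  -- small. The bound 2 ≤ k₀ η then excludes the value -η or below from the EDF domain.
  constraint : ∃ η : ℝ, 0 < η ∧ m * η ^ 2 < κ * r ^ 2 ∧ 2 ≤ k₀ * η ∧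
    δ * (m * (1 + B * r / γ)) < τ₀ * νm * η / 2
  level : δ * (m * (1 + B * r / γ)) ≤ 1 / 8
  multiplier : m * (δ / γ * B) / α ≤ τ₀ * νm / 8
  scaling : 4 ≤ k₀ * νm
  lt_multiplier : δ < τ₀ * νm

/-- Fix η first. Every upper bound on δ is then a positive number, and k₀ depends on η and `νm`
only. -/
theorem exists_dualThresholds (m : ℕ) (hr : 0 < r) (hκ : 0 < κ) (hνm : 0 < νm) (hτ₀ : 0 < τ₀) :
    ∃ δ k₀ : ℝ, DualThresholds m r κ γ B α νm τ₀ δ k₀ := by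
  have hη : ∃ η : ℝ, 0 < η ∧ m * η ^ 2 < κ * r ^ 2 := by
    have h : ∀ᶠ η in 𝓝[>] (0 : ℝ), 0 < η ∧ m * η ^ 2 < κ * r ^ 2 := by
      refine eventually_mem_nhdsWithin.and (Eventually.filter_mono nhdsWithin_le_nhds ?_)
      have h1 : ContinuousAt (fun η : ℝ => m * η ^ 2) 0 := by fun_prop
      refine h1.eventually (eventually_lt_nhds ?_)
      simp only [ne_eq, OfNat.ofNat_ne_zero, not_false_eq_true, zero_pow, mul_zero]
      positivity
    exact h.exists
  obtain ⟨η, hη, hη2⟩ := hη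
  have hsmall : ∀ C ε : ℝ, 0 < ε → ∀ᶠ δ in 𝓝 (0 : ℝ), δ * C < ε := by
    intro C ε hε
    have h1 : ContinuousAt (fun δ : ℝ => δ * C) 0 := by fun_prop
    refine h1.eventually (eventually_lt_nhds ?_)
    simpa using hε
  set C := m * (1 + B * r / γ)
  have hev : ∀ᶠ δ in 𝓝[>] (0 : ℝ), 0 < δ ∧ δ * C < τ₀ * (κ * r ^ 2 / 2) ∧
      δ * C < τ₀ * νm * η / 2 ∧ δ * C < 1 / 8 ∧ δ * (m / γ * B / α) < τ₀ * νm / 8 ∧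
      δ * 1 < τ₀ * νm := by
    refine eventually_mem_nhdsWithin.and (Eventually.filter_mono nhdsWithin_le_nhds ?_)
    exact (hsmall _ _ (by positivity)).and ((hsmall _ _ (by positivity)).and
      ((hsmall _ _ (by positivity)).and ((hsmall _ _ (by positivity)).and
        (hsmall _ _ (by positivity)))))
  obtain ⟨δ, hδ, h1, h2, h3, h4, h5⟩ := hev.exists
  refine ⟨δ, max (2 / η) (4 / νm), hδ, by positivity, h1, ⟨η, hη, hη2, ?_, h2⟩, h3.le, ?_, ?_, ?_⟩
  · exact (div_le_iff₀ hη).1 (le_max_left _ _)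
  · refine le_trans (le_of_eq ?_) h4.le
    ring
  · exact (div_le_iff₀ hνm).1 (le_max_right _ _)
  · linarith

/-- The exterior distance function increases radially on the boundary of the ball. -/
theorem LocalEstimates.radial_pos
    (H : LocalEstimates f c xs ν r κ γ B α K νm) (hreg : RegularKKT f c xs ν)
    (hf : ContDiff ℝ 2 f) (hc : ∀ i, ContDiff ℝ 2 (c i))
    (hfconv : ConvexOn ℝ univ f) (hcconc : ∀ i, ConcaveOn ℝ univ (c i))
    (hD : DualThresholds m r κ γ B α νm τ₀ δ k₀) (hτ₀ : 0 < τ₀)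
    (hy : f xs < f y) (hτ : τ₀ ≤ (f y - f xs)⁻¹) (hk₀ : k₀ ≤ k) (hl : ∀ i, 0 ≤ l i)
    (hδ : ∀ i, |l i - (f y - f xs)⁻¹ * ν i| ≤ δ * k)
    (hx : x ∈ edfDomain f c y k) (hxr : x ∈ Metric.sphere xs r) :
    0 < inner ℝ (gradient (edf f c y l k) x) (x - xs) := by
  have hk : 0 < k := hD.k₀_pos.trans_le hk₀
  have hxb : x ∈ Metric.closedBall xs r := Metric.sphere_subset_closedBall hxr
  have hnorm : ‖x - xs‖ = r := by rw [← dist_eq_norm]; exact hxr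
  have hσ : 0 < f y - f xs := sub_pos.2 hy
  have ha : 0 < f y - f x := sub_pos.2 hx.1
  set τ := (f y - f xs)⁻¹ with hτdef
  have hτpos : 0 < τ := hτ₀.trans_le hτ
  have hpass : ∀ i, i ∉ activeSet c xs → l i ≤ δ * k := fun i hi => by
    have := hδ i
    rw [hreg.passive_eq i hi, mul_zero, sub_zero] at this
    exact (le_abs_self _).trans this
  have hE := H.energy_le hreg hf hc hfconv hcconc hy hk hl hx hxb hD.δ_pos.le hpass
  rw [hnorm, ← hτdef] at hE
  refine lt_of_lt_of_le ?_ hE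
  have hG := hreg.lagrangian_nonneg hf hc hfconv hcconc x
  have hgrowth := H.growth x hxb
  rw [hnorm] at hgrowth
  set G := f x - f xs - ∑ i, ν i * c i x with hGdef
  have hlevel : 0 ≤ (f x - f xs) ^ 2 / ((f y - f x) * (f y - f xs)) := by positivity
  have hτν : ∀ i, 0 ≤ τ * ν i := fun i => mul_nonneg hτpos.le (hreg.multiplier_nonneg i)
  have hterm : ∀ i, -δ ≤ (τ * ν i - multiplierUpdate c l k x i) * c i x := fun i =>
    neg_le_multiplier_defect_mul hk (hτν i) (hl i) (hx.2 i) (hδ i)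
  have hcard : ((activeSet c xs).card : ℝ) ≤ m := by
    exact_mod_cast (Finset.card_le_univ _).trans_eq (Fintype.card_fin m)
  have hC : δ * (m * (1 + B * r / γ)) = m * δ + m * (δ / γ * (B * r)) := by ring
  have hδ0 := hD.δ_pos
  -- By growth on the sphere, either G or half the sum of squared active constraints is at least
  -- κr²/2. In the second case some active |c_i| reaches η, and its complementarity term is large.
  by_cases hcase : κ * r ^ 2 / 2 ≤ G
  · have h1 : -(m * δ) ≤ ∑ i ∈ activeSet c xs,
        (τ * ν i - multiplierUpdate c l k x i) * c i x := by
      have h2 := Finset.sum_le_sum (s := activeSet c xs) fun i _ => hterm i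
      rw [Finset.sum_const, nsmul_eq_mul] at h2
      have h3 := mul_le_mul_of_nonneg_right hcard hδ0.le
      linarith
    have h3 : τ₀ * (κ * r ^ 2 / 2) ≤ τ * G := by
      have := H.κ_pos
      exact mul_le_mul hτ hcase (by positivity) hτpos.le
    have := hD.growth
    linarith
  · obtain ⟨η, hη, hη2, hkη, hδη⟩ := hD.constraint
    obtain ⟨i, hi, hci⟩ : ∃ i ∈ activeSet c xs, η ≤ |c i x| := by
      by_contra! hcon
      have h1 : ∑ i ∈ activeSet c xs, c i x ^ 2 ≤ m * η ^ 2 := by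
        calc ∑ i ∈ activeSet c xs, c i x ^ 2 ≤ ∑ _i ∈ activeSet c xs, η ^ 2 :=
              Finset.sum_le_sum fun i hi => sq_le_sq' (abs_lt.1 (hcon i hi)).1.le
                (abs_lt.1 (hcon i hi)).2.le
          _ = (activeSet c xs).card * η ^ 2 := by rw [Finset.sum_const, nsmul_eq_mul]
          _ ≤ m * η ^ 2 := by gcongr
      linarith
    have hkη' : 2 ≤ k * η := hkη.trans (mul_le_mul_of_nonneg_right hk₀ hη.le)
    have hci' : η ≤ c i x := by
      rcases le_abs.1 hci with h | h
      · exact h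
      · have h1 := hx.2 i
        have h2 := mul_le_mul_of_nonneg_left h hk.le
        linarith
    have hνi := H.le_multiplier i hi
    -- As c/(kc + 1) ≤ 1/k, the updated term is at most l_i/k ≤ τν_i/k + δ ≤ τν_i η/2 + δ, so half
    -- of τν_i η remains.
    have hmain : τ₀ * νm * η / 2 - δ ≤ (τ * ν i - multiplierUpdate c l k x i) * c i x := by
      have h1 : multiplierUpdate c l k x i * c i x ≤ l i / k := by
        have h2 := hx.2 i
        have h3 := hl i
        rw [multiplierUpdate, mul_assoc, div_eq_mul_inv]
        refine mul_le_mul_of_nonneg_left ?_ h3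
        rw [inv_mul_le_iff₀ h2, ← div_eq_mul_inv, le_div_iff₀ hk]
        linarith
      have h4 : l i / k ≤ τ * ν i * (η / 2) + δ := by
        rw [div_le_iff₀ hk]
        have h5 := (abs_le.1 (hδ i)).2
        have h6 := mul_le_mul_of_nonneg_left hkη' (hτν i)
        linarith
      have h7 : τ * ν i * η ≤ τ * ν i * c i x := mul_le_mul_of_nonneg_left hci' (hτν i)
      have h8 : τ₀ * νm * η ≤ τ * ν i * η :=
        mul_le_mul_of_nonneg_right (mul_le_mul hτ hνi H.νm_pos.le hτpos.le) hη.le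
      linarith
    have hsum : τ₀ * νm * η / 2 - m * δ ≤ ∑ i ∈ activeSet c xs,
        (τ * ν i - multiplierUpdate c l k x i) * c i x := by
      rw [← Finset.add_sum_erase _ _ hi]
      have h2 := Finset.sum_le_sum (s := (activeSet c xs).erase i) fun i _ => hterm i
      rw [Finset.sum_const, nsmul_eq_mul] at h2
      have h3 : (((activeSet c xs).erase i).card : ℝ) + 1 ≤ m := by
        refine le_trans (le_of_eq ?_) hcard
        exact_mod_cast Finset.card_erase_add_one hi
      have h4 := mul_le_mul_of_nonneg_right h3 hδ0.le
      have h5 := add_le_add hmain h2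
      linarith
    have h9 : 0 ≤ τ * G := mul_nonneg hτpos.le hG
    linarith

/-- At a critical point near the solution, the gap `f y - f x` is comparable with
`f y - f xs`. -/
theorem LocalEstimates.gap_bounds
    (H : LocalEstimates f c xs ν r κ γ B α K νm) (hreg : RegularKKT f c xs ν)
    (hf : ContDiff ℝ 2 f) (hc : ∀ i, ContDiff ℝ 2 (c i))
    (hfconv : ConvexOn ℝ univ f) (hcconc : ∀ i, ConcaveOn ℝ univ (c i))
    (hD : DualThresholds m r κ γ B α νm τ₀ δ k₀)
    (hy : f xs < f y) (hk₀ : k₀ ≤ k) (hl : ∀ i, 0 ≤ l i)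
    (hδ : ∀ i, |l i - (f y - f xs)⁻¹ * ν i| ≤ δ * k)
    (hx : x ∈ edfDomain f c y k) (hxr : x ∈ Metric.closedBall xs r)
    (hcrit : gradient (edf f c y l k) x = 0) :
    (f y - f xs) / 2 ≤ f y - f x ∧ f y - f x ≤ 2 * (f y - f xs) := by
  have hk : 0 < k := hD.k₀_pos.trans_le hk₀
  have hσ : 0 < f y - f xs := sub_pos.2 hy
  have ha : 0 < f y - f x := sub_pos.2 hx.1
  have hpass : ∀ i, i ∉ activeSet c xs → l i ≤ δ * k := fun i hi => by
    have := hδ i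
    rw [hreg.passive_eq i hi, mul_zero, sub_zero] at this
    exact (le_abs_self _).trans this
  have hE := H.energy_le hreg hf hc hfconv hcconc hy hk hl hx hxr hD.δ_pos.le hpass
  rw [hcrit, inner_zero_left] at hE
  have hδ0 := hD.δ_pos
  have hγ := H.γ_pos
  have hB := H.B_nonneg
  have hnorm : ‖x - xs‖ ≤ r := by rw [← dist_eq_norm]; exact hxr
  have h1 : (m : ℝ) * (δ / γ * (B * ‖x - xs‖)) ≤ m * (δ / γ * (B * r)) := by gcongr
  have hG : 0 ≤ (f y - f xs)⁻¹ * (f x - f xs - ∑ i, ν i * c i x) :=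
    mul_nonneg (inv_pos.2 hσ).le (hreg.lagrangian_nonneg hf hc hfconv hcconc x)
  have h2 : -(m * δ) ≤ ∑ i ∈ activeSet c xs,
      ((f y - f xs)⁻¹ * ν i - multiplierUpdate c l k x i) * c i x := by
    have h3 := Finset.sum_le_sum (s := activeSet c xs) fun i _ =>
      neg_le_multiplier_defect_mul hk
        (mul_nonneg (inv_pos.2 hσ).le (hreg.multiplier_nonneg i)) (hl i) (hx.2 i) (hδ i)
    rw [Finset.sum_const, nsmul_eq_mul] at h3
    have hcard : ((activeSet c xs).card : ℝ) ≤ m := by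
      exact_mod_cast (Finset.card_le_univ _).trans_eq (Fintype.card_fin m)
    refine le_trans ?_ h3
    nlinarith
  have hC : δ * (m * (1 + B * r / γ)) = m * δ + m * (δ / γ * (B * r)) := by ring
  have h4 : (f x - f xs) ^ 2 / ((f y - f x) * (f y - f xs)) ≤ 1 / 8 := by
    linarith [hD.level]
  rw [div_le_iff₀ (by positivity)] at h4
  obtain ⟨a, hadef⟩ : ∃ a, a = f y - f x := ⟨_, rfl⟩
  obtain ⟨σ, hσdef⟩ : ∃ σ, σ = f y - f xs := ⟨_, rfl⟩
  have h5 : f x - f xs = σ - a := by rw [hadef, hσdef]; ring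
  rw [h5, ← hadef, ← hσdef] at h4
  rw [← hadef, ← hσdef]
  rw [← hadef] at ha
  rw [← hσdef] at hσ
  -- The energy inequality has become (σ - a)² ≤ aσ/8, which fails if a < σ/2 and if a > 2σ.
  constructor
  · by_contra! h
    nlinarith
  · by_contra! h
    nlinarith

/-- Stationarity determines the updated active multipliers up to the residual. -/
theorem LocalEstimates.multiplier_sub_le
    (H : LocalEstimates f c xs ν r κ γ B α K νm) (hreg : RegularKKT f c xs ν)
    (hf : ContDiff ℝ 2 f) (hc : ∀ i, ContDiff ℝ 2 (c i))
    (hk : 0 < k) (hl : ∀ i, 0 ≤ l i) (hT0 : 0 ≤ T)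
    (hT : ∀ i, i ∉ activeSet c xs → l i ≤ T * k)
    (hx : x ∈ edfDomain f c y k) (hxr : x ∈ Metric.closedBall xs r)
    (hcrit : gradient (edf f c y l k) x = 0) {i : Fin m} (hi : i ∈ activeSet c xs) :
    α * |multiplierUpdate c l k x i - (f y - f x)⁻¹ * ν i|
      ≤ (f y - f x)⁻¹ * (K * ‖x - xs‖) + m * (T / γ * B) := by
  have ha : 0 < (f y - f x)⁻¹ := inv_pos.2 (sub_pos.2 hx.1)
  refine (H.independent x hxr
    (fun i => multiplierUpdate c l k x i - (f y - f x)⁻¹ * ν i) i hi).trans ?_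
  rw [(hasGradientAt_edf (l := l) hf hc hk.ne' hx).gradient, sub_eq_zero] at hcrit
  have hsplit : ∀ b : Fin m → ℝ, ∑ i, b i • gradient (c i) x
      = ∑ i ∈ activeSet c xs, b i • gradient (c i) x
        + ∑ i ∈ (activeSet c xs)ᶜ, b i • gradient (c i) x := fun b =>
    (Finset.sum_add_sum_compl _ _).symm
  have hν0 : ∑ i ∈ (activeSet c xs)ᶜ, ν i • gradient (c i) x = 0 :=
    Finset.sum_eq_zero fun i hi => by
      rw [hreg.passive_eq i (Finset.mem_compl.1 hi), zero_smul]
  -- Stationarity expresses the active defect as the weighted Lagrangian residual minus the passive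
  -- part, and both are small.
  have heq : ∑ j ∈ activeSet c xs,
      (multiplierUpdate c l k x j - (f y - f x)⁻¹ * ν j) • gradient (c j) x
      = (f y - f x)⁻¹ • (gradient f x - ∑ i, ν i • gradient (c i) x)
        - ∑ i ∈ (activeSet c xs)ᶜ, multiplierUpdate c l k x i • gradient (c i) x := by
    rw [smul_sub, hcrit, hsplit (multiplierUpdate c l k x), hsplit ν, hν0]
    simp only [sub_smul, Finset.sum_sub_distrib, mul_smul, add_zero, Finset.smul_sum]
    abel
  rw [heq]
  refine (norm_sub_le _ _).trans (add_le_add ?_ ?_)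
  · rw [norm_smul, Real.norm_of_nonneg ha.le]
    exact mul_le_mul_of_nonneg_left (H.residual x hxr) ha.le
  · have hγ := H.γ_pos
    have hB := H.B_nonneg
    calc ‖∑ i ∈ (activeSet c xs)ᶜ, multiplierUpdate c l k x i • gradient (c i) x‖
        ≤ ∑ i ∈ (activeSet c xs)ᶜ, ‖multiplierUpdate c l k x i • gradient (c i) x‖ :=
          norm_sum_le _ _
      _ ≤ ∑ _i ∈ (activeSet c xs)ᶜ, T / γ * B := by
          refine Finset.sum_le_sum fun j hj => ?_
          have hj' := Finset.mem_compl.1 hj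
          rw [norm_smul, Real.norm_of_nonneg (multiplierUpdate_nonneg hl hx j)]
          exact mul_le_mul (H.multiplierUpdate_passive_le hk hl hxr hj' (hT j hj'))
            (H.gradient_le x hxr j) (norm_nonneg _) (by positivity)
      _ = (activeSet c xs)ᶜ.card * (T / γ * B) := by rw [Finset.sum_const, nsmul_eq_mul]
      _ ≤ m * (T / γ * B) := by
          refine mul_le_mul_of_nonneg_right ?_ (by positivity)
          exact_mod_cast (Finset.card_le_univ _).trans_eq (Fintype.card_fin m)

/-- The weight at x is at least τ/2. The residual takes a quarter of it times `νm` and the passive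
part at most τ νm/8, leaving 3/8 - 1/8 = 1/4. This keeps the later divisions by updated multipliers
bounded. -/
theorem LocalEstimates.multiplier_lower_bound
    (H : LocalEstimates f c xs ν r κ γ B α K νm) (hreg : RegularKKT f c xs ν)
    (hf : ContDiff ℝ 2 f) (hc : ∀ i, ContDiff ℝ 2 (c i))
    (hfconv : ConvexOn ℝ univ f) (hcconc : ∀ i, ConcaveOn ℝ univ (c i))
    (hD : DualThresholds m r κ γ B α νm τ₀ δ k₀)
    (hy : f xs < f y) (hτ : τ₀ ≤ (f y - f xs)⁻¹) (hk₀ : k₀ ≤ k) (hl : ∀ i, 0 ≤ l i)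
    (hδ : ∀ i, |l i - (f y - f xs)⁻¹ * ν i| ≤ δ * k)
    (hx : x ∈ edfDomain f c y k) (hxr : x ∈ Metric.closedBall xs r)
    (hcrit : gradient (edf f c y l k) x = 0) {i : Fin m} (hi : i ∈ activeSet c xs) :
    (f y - f xs)⁻¹ * νm / 4 ≤ multiplierUpdate c l k x i := by
  have hk : 0 < k := hD.k₀_pos.trans_le hk₀
  have hσ : 0 < f y - f xs := sub_pos.2 hy
  have ha : 0 < f y - f x := sub_pos.2 hx.1
  have hα := H.α_pos
  have hpass : ∀ i, i ∉ activeSet c xs → l i ≤ δ * k := fun i hi => by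
    have := hδ i
    rw [hreg.passive_eq i hi, mul_zero, sub_zero] at this
    exact (le_abs_self _).trans this
  have h1 := H.multiplier_sub_le hreg hf hc hk hl hD.δ_pos.le hpass hx hxr hcrit hi
  have hgap := (H.gap_bounds hreg hf hc hfconv hcconc hD hy hk₀ hl hδ hx hxr hcrit).2
  have hw : (f y - f xs)⁻¹ / 2 ≤ (f y - f x)⁻¹ := by
    rw [div_eq_mul_inv, ← mul_inv, mul_comm]
    exact inv_anti₀ ha hgap
  have hnorm : ‖x - xs‖ ≤ r := by rw [← dist_eq_norm]; exact hxr
  have h2 : K * ‖x - xs‖ ≤ α * νm / 4 :=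
    (mul_le_mul_of_nonneg_left hnorm H.K_nonneg).trans H.radius_le
  have h3 : m * (δ / γ * B) ≤ α * (τ₀ * νm / 8) := by
    have := (div_le_iff₀ hα).1 hD.multiplier
    linarith
  have hwpos : 0 < (f y - f x)⁻¹ := inv_pos.2 ha
  have h4 : α * |multiplierUpdate c l k x i - (f y - f x)⁻¹ * ν i|
      ≤ α * ((f y - f x)⁻¹ * νm / 4 + τ₀ * νm / 8) := by
    have := mul_le_mul_of_nonneg_left h2 hwpos.le
    linarith
  have h5 := (abs_le.1 (le_of_mul_le_mul_left h4 hα)).1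
  have h6 := mul_le_mul_of_nonneg_left (H.le_multiplier i hi) hwpos.le
  have h7 := mul_le_mul_of_nonneg_right hw H.νm_pos.le
  have h8 := mul_le_mul_of_nonneg_right hτ H.νm_pos.le
  linarith

set_option maxHeartbeats 1000000 in
/-- Linear error bound for the primal and dual variables, uniform in the scaling parameter. -/
theorem LocalEstimates.exists_error_bound
    (H : LocalEstimates f c xs ν r κ γ B α K νm) (hreg : RegularKKT f c xs ν)
    (hf : ContDiff ℝ 2 f) (hc : ∀ i, ContDiff ℝ 2 (c i))
    (hfconv : ConvexOn ℝ univ f) (hcconc : ∀ i, ConcaveOn ℝ univ (c i))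
    (hD : DualThresholds m r κ γ B α νm τ₀ δ k₀)
    (hy : f xs < f y) (hτ : τ₀ ≤ (f y - f xs)⁻¹) :
    ∃ C : ℝ, 0 < C ∧ ∀ (l : Fin m → ℝ) (k T : ℝ) (x : EuclideanSpace ℝ (Fin n)),
      k₀ ≤ k → (∀ i, 0 ≤ l i) → (∀ i, |l i - (f y - f xs)⁻¹ * ν i| ≤ δ * k) → 0 ≤ T →
      (∀ i, |l i - (f y - f xs)⁻¹ * ν i| ≤ T * k) →
      x ∈ edfDomain f c y k → x ∈ Metric.closedBall xs r →
      gradient (edf f c y l k) x = 0 →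
      ‖x - xs‖ ≤ C * T ∧
        ∀ i, |multiplierUpdate c l k x i - (f y - f xs)⁻¹ * ν i| ≤ C * T := by
  have hσ : 0 < f y - f xs := sub_pos.2 hy
  have hγ := H.γ_pos
  have hB := H.B_nonneg
  have hα := H.α_pos
  have hK := H.K_nonneg
  have hκ := H.κ_pos
  have hνm := H.νm_pos
  obtain ⟨τ, hτdef⟩ : ∃ τ, τ = (f y - f xs)⁻¹ := ⟨_, rfl⟩
  have hτpos : 0 < τ := by rw [hτdef]; exact inv_pos.2 hσ
  set N := ∑ i, ν i with hN
  have hN0 : 0 ≤ N := Finset.sum_nonneg fun i _ => hreg.multiplier_nonneg i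
  set β := τ * νm / 4 with hβ
  have hβ0 : 0 < β := by positivity
  -- `C₃` bounds the active dual error by U + T: the first summand is the stationarity defect, the
  -- second the change of weight from f(y) - f(xs) to f(y) - f(x). `C₄` then collects the energy
  -- terms, and `C₅` divides by the growth constant.
  set C₃ := (2 * τ * K + m * (B / γ)) / α + N * (2 * τ ^ 2 * B) with hC₃
  have hC₃0 : 0 ≤ C₃ := by positivity
  set C₄ := m * (τ / β ^ 2 + C₃ / β + B / γ) with hC₄
  have hC₄0 : 0 ≤ C₄ := by positivity
  set C₅ := C₄ / (τ * κ) with hC₅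
  have hC₅0 : 0 ≤ C₅ := by positivity
  refine ⟨(C₃ + 1) * (C₅ + 2) + 1 / γ, by positivity, ?_⟩
  intro l k T x hk₀ hl hδ hT0 hT hx hxr hcrit
  have hk : 0 < k := hD.k₀_pos.trans_le hk₀
  have ha : 0 < f y - f x := sub_pos.2 hx.1
  have hpass : ∀ i, i ∉ activeSet c xs → l i ≤ T * k := fun i hi => by
    have := hT i
    rw [hreg.passive_eq i hi, mul_zero, sub_zero] at this
    exact (le_abs_self _).trans this
  obtain ⟨hgap, -⟩ := H.gap_bounds hreg hf hc hfconv hcconc hD hy hk₀ hl hδ hx hxr hcrit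
  have hlow : ∀ i ∈ activeSet c xs, β ≤ multiplierUpdate c l k x i := fun i hi => by
    rw [hβ, hτdef]
    exact H.multiplier_lower_bound hreg hf hc hfconv hcconc hD hy hτ hk₀ hl hδ hx hxr hcrit hi
  have hE := H.energy_le hreg hf hc hfconv hcconc hy hk hl hx hxr hT0 hpass
  rw [hcrit, inner_zero_left] at hE
  rw [← hτdef] at hE hT ⊢
  have hw : (f y - f x)⁻¹ ≤ 2 * τ := by
    rw [hτdef]
    calc (f y - f x)⁻¹ ≤ ((f y - f xs) / 2)⁻¹ := inv_anti₀ (by positivity) hgap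
      _ = 2 * (f y - f xs)⁻¹ := by rw [inv_div]; ring
  have hwpos : 0 < (f y - f x)⁻¹ := inv_pos.2 ha
  set U := ‖x - xs‖ with hU
  have hU0 : 0 ≤ U := norm_nonneg _
  have hwτ : |(f y - f x)⁻¹ - τ| ≤ 2 * τ ^ 2 * B * U := by
    have h1 : (f y - f x)⁻¹ - τ = (f y - f x)⁻¹ * τ * (f x - f xs) := by
      rw [hτdef]; field_simp; ring
    rw [h1, abs_mul, abs_of_pos (mul_pos hwpos hτpos)]
    calc (f y - f x)⁻¹ * τ * |f x - f xs| ≤ 2 * τ * τ * (B * U) := by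
          have := H.objective_le x hxr
          gcongr
      _ = 2 * τ ^ 2 * B * U := by ring
  have hΔ : ∀ i ∈ activeSet c xs, |multiplierUpdate c l k x i - τ * ν i| ≤ C₃ * (U + T) := by
    intro i hi
    have h1 := H.multiplier_sub_le hreg hf hc hk hl hT0 hpass hx hxr hcrit hi
    rw [mul_comm, ← le_div_iff₀ hα] at h1
    have h2 : ((f y - f x)⁻¹ * (K * ‖x - xs‖) + m * (T / γ * B)) / α
        ≤ (2 * τ * K + m * (B / γ)) / α * (U + T) := by
      rw [div_mul_eq_mul_div (2 * τ * K + m * (B / γ)) α (U + T)]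
      refine div_le_div_of_nonneg_right ?_ hα.le
      have h3 : (f y - f x)⁻¹ * (K * U) ≤ 2 * τ * (K * U) :=
        mul_le_mul_of_nonneg_right hw (by positivity)
      have h4 : 0 ≤ 2 * τ * K * T := by positivity
      have h5 : 0 ≤ m * (B / γ) * U := by positivity
      have h6 : (m : ℝ) * (T / γ * B) = m * (B / γ) * T := by ring
      rw [h6]
      linarith
    have h7 : |((f y - f x)⁻¹ - τ) * ν i| ≤ N * (2 * τ ^ 2 * B) * (U + T) := by
      have hνi := hreg.multiplier_nonneg i
      have hνN : ν i ≤ N :=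
        Finset.single_le_sum (fun j _ => hreg.multiplier_nonneg j) (Finset.mem_univ i)
      rw [abs_mul, abs_of_nonneg hνi]
      calc |(f y - f x)⁻¹ - τ| * ν i ≤ 2 * τ ^ 2 * B * U * N := by gcongr
        _ ≤ 2 * τ ^ 2 * B * (U + T) * N := by gcongr; linarith
        _ = N * (2 * τ ^ 2 * B) * (U + T) := by ring
    have h8 : multiplierUpdate c l k x i - τ * ν i
        = (multiplierUpdate c l k x i - (f y - f x)⁻¹ * ν i) + ((f y - f x)⁻¹ - τ) * ν i := by
      ring
    rw [h8]
    refine (abs_add_le _ _).trans ?_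
    rw [hC₃, add_mul]
    linarith
  have hquad : ∀ i ∈ activeSet c xs,
      1 / 2 * τ * c i x ^ 2 + (multiplierUpdate c l k x i - τ * ν i) * c i x
        ≤ τ * T ^ 2 / β ^ 2 + C₃ * (U + T) * T / β := by
    intro i hi
    have hL := hβ0.trans_le (hlow i hi)
    have hz := hx.2 i
    -- This is the update rule λ̂_i (k c_i + 1) = l_i solved for λ̂_i c_i.
    have h1 : multiplierUpdate c l k x i * c i x
        = (l i - τ * ν i) / k - k⁻¹ * (multiplierUpdate c l k x i - τ * ν i) := by
      simp only [multiplierUpdate]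
      have hz' := hz.ne'
      field_simp
      ring
    have h2 : τ * k⁻¹ ≤ multiplierUpdate c l k x i := by
      refine le_trans ?_ (hlow i hi)
      rw [hβ, ← div_eq_mul_inv, div_le_iff₀ hk]
      have h3 : 4 ≤ k * νm := hD.scaling.trans (mul_le_mul_of_nonneg_right hk₀ hνm.le)
      nlinarith
    refine (quadratic_complementarity_le hτpos.le (inv_pos.2 hk).le hL h1 h2).trans ?_
    have h4 : |(l i - τ * ν i) / k| ≤ T := by
      rw [abs_div, abs_of_pos hk, div_le_iff₀ hk]; exact hT i
    refine add_le_add ?_ ?_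
    · have h5 : ((l i - τ * ν i) / k) ^ 2 ≤ T ^ 2 := sq_le_sq' (abs_le.1 h4).1 (abs_le.1 h4).2
      have := hlow i hi
      gcongr
    · calc (multiplierUpdate c l k x i - τ * ν i) * ((l i - τ * ν i) / k)
            / multiplierUpdate c l k x i
          ≤ C₃ * (U + T) * T / multiplierUpdate c l k x i := by
            refine div_le_div_of_nonneg_right ?_ hL.le
            refine (le_abs_self _).trans ?_
            rw [abs_mul]
            exact mul_le_mul (hΔ i hi) h4 (abs_nonneg _) (by positivity)
        _ ≤ C₃ * (U + T) * T / β :=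
            div_le_div_of_nonneg_left (by positivity) hβ0 (hlow i hi)
  have hsum : 1 / 2 * τ * ∑ i ∈ activeSet c xs, c i x ^ 2
      - ∑ i ∈ activeSet c xs, (τ * ν i - multiplierUpdate c l k x i) * c i x
      ≤ m * (τ * T ^ 2 / β ^ 2 + C₃ * (U + T) * T / β) := by
    rw [Finset.mul_sum, ← Finset.sum_sub_distrib]
    have h1 := Finset.sum_le_sum hquad
    rw [Finset.sum_const, nsmul_eq_mul] at h1
    have hcard : ((activeSet c xs).card : ℝ) ≤ m := by
      exact_mod_cast (Finset.card_le_univ _).trans_eq (Fintype.card_fin m)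
    have h2 : 0 ≤ τ * T ^ 2 / β ^ 2 + C₃ * (U + T) * T / β := by positivity
    refine le_trans (le_of_eq ?_) (h1.trans (mul_le_mul_of_nonneg_right hcard h2))
    exact Finset.sum_congr rfl fun i _ => by ring
  have hlevel : 0 ≤ (f x - f xs) ^ 2 / ((f y - f x) * (f y - f xs)) := by positivity
  have hgrowth := mul_le_mul_of_nonneg_left (H.growth x hxr) hτpos.le
  -- Add τ times the growth estimate, the energy inequality with zero gradient and `hsum`; the
  -- squares of the active constraints cancel.
  have hfin : τ * κ * U ^ 2 ≤ C₄ * (T ^ 2 + U * T) := by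
    have h1 : C₄ * (T ^ 2 + U * T) = m * (τ * T ^ 2 / β ^ 2 + C₃ * (U + T) * T / β)
        + m * (T / γ * (B * U)) + (m * (τ / β ^ 2) * (U * T) + m * (B / γ) * T ^ 2) := by
      rw [hC₄]; ring
    have h2 : 0 ≤ m * (τ / β ^ 2) * (U * T) + m * (B / γ) * T ^ 2 := by positivity
    rw [h1]
    linarith
  have hUT : U ≤ (C₅ + 1) * T := by
    have h1 : U ^ 2 ≤ C₅ * (T ^ 2 + U * T) := by
      rw [hC₅, div_mul_eq_mul_div, le_div_iff₀ (by positivity)]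
      linarith
    by_contra! h
    have h2 : 0 ≤ (C₅ + 1) * T := by positivity
    have h3 : 0 < U := h2.trans_lt h
    have h4 := mul_lt_mul_of_pos_right h h3
    have h5 := mul_le_mul_of_nonneg_right h.le hT0
    have h6 := sq_nonneg T
    linarith
  have hTγ : 0 ≤ 1 / γ * T := by positivity
  have hexp : ((C₃ + 1) * (C₅ + 2) + 1 / γ) * T
      = C₃ * ((C₅ + 2) * T) + (C₅ + 2) * T + 1 / γ * T := by ring
  have hC₅T : 0 ≤ (C₅ + 2) * T := by positivity
  have hC₃T : 0 ≤ C₃ * ((C₅ + 2) * T) := by positivity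
  rw [hexp]
  refine ⟨by linarith, fun i => ?_⟩
  by_cases hi : i ∈ activeSet c xs
  · refine (hΔ i hi).trans ?_
    have : C₃ * (U + T) ≤ C₃ * ((C₅ + 2) * T) :=
      mul_le_mul_of_nonneg_left (by linarith) hC₃0
    linarith
  · rw [hreg.passive_eq i hi, mul_zero, sub_zero,
      abs_of_nonneg (multiplierUpdate_nonneg hl hx i)]
    have := H.multiplierUpdate_passive_le hk hl hxr hi (hpass i hi)
    rw [div_eq_mul_one_div, mul_comm] at this
    linarith

end ErrorBounds

end ExteriorDistance

end

noncomputable section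

namespace ExteriorDistance

open Set Filter Topology

/-! ### From the transformed problems to one KKT system. -/

section Regularity

variable {n m : ℕ} {f : EuclideanSpace ℝ (Fin n) → ℝ}
  {c : Fin m → EuclideanSpace ℝ (Fin n) → ℝ}
  {xs y : EuclideanSpace ℝ (Fin n)} {l : Fin m → ℝ}

theorem lagrangian_eq_separable : lagrangian f c y l = fun x =>
    (fun v => -Real.log (f y - v)) (f x) + ∑ i, (fun v => -l i * v) (c i x) := by
  ext x
  simp [lagrangian, transformedObjective, sub_eq_add_neg]

theorem gradient_lagrangian (hf : ContDiff ℝ 2 f) (hc : ∀ i, ContDiff ℝ 2 (c i))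
    (hy : f xs < f y) :
    gradient (lagrangian f c y l) xs
      = (f y - f xs)⁻¹ • gradient f xs - ∑ i, l i • gradient (c i) xs := by
  have h := hasGradientAt_separable (hf.differentiable two_ne_zero xs)
    (fun i => (hc i).differentiable two_ne_zero xs) (hasDerivAt_neg_log_sub hy)
    (fun i => (hasDerivAt_id (c i xs)).const_mul (-l i))
  rw [lagrangian_eq_separable]
  refine h.gradient.trans ?_
  simp [sub_eq_add_neg]

theorem hessian_lagrangian_inner (hf : ContDiff ℝ 2 f) (hc : ∀ i, ContDiff ℝ 2 (c i))
    (hy : f xs < f y) (u : EuclideanSpace ℝ (Fin n)) :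
    inner ℝ (hessian (lagrangian f c y l) xs u) u
      = (f y - f xs)⁻¹ * inner ℝ (hessian f xs u) u
        + ((f y - f xs) ^ 2)⁻¹ * inner ℝ (gradient f xs) u ^ 2
        - ∑ i, l i * inner ℝ (hessian (c i) xs u) u := by
  rw [lagrangian_eq_separable, hessian_separable_inner hf hc
    ((eventually_lt_nhds hy).mono fun v hv => hasDerivAt_neg_log_sub hv)
    (q := fun i v => -l i * v) (q' := fun i _ => -l i) (q'' := fun _ => 0)
    (fun i => Eventually.of_forall fun v => 
      ((hasDerivAt_id v).const_mul (-l i)).congr_deriv (mul_one _))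
    (hasDerivAt_inv_sub hy) (fun i => hasDerivAt_const _ _) u]
  simp [sub_eq_add_neg]

theorem activeJacobian_mulVec (u : EuclideanSpace ℝ (Fin n)) (i : {i : Fin m // c i xs = 0}) :
    (activeJacobian c xs).mulVec u.ofLp i = inner ℝ (gradient (c i.1) xs) u := by
  rw [PiLp.inner_apply]
  simp [activeJacobian, Matrix.mulVec, dotProduct, mul_comm]

theorem linearIndependent_of_full_rank
    (h : (activeJacobian c xs).rank = Nat.card {i : Fin m // c i xs = 0}) :
    LinearIndependent ℝ fun i : {i // i ∈ activeSet c xs} => gradient (c i.1) xs := by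
  have h1 : LinearIndependent ℝ (activeJacobian c xs).row := by
    rw [linearIndependent_iff_card_eq_finrank_span, Set.finrank,
      ← Matrix.rank_eq_finrank_span_row, h, Nat.card_eq_fintype_card]
  have h2 : LinearIndependent ℝ fun i : {i : Fin m // c i xs = 0} => gradient (c i.1) xs :=
    LinearIndependent.of_comp (WithLp.linearEquiv 2 ℝ (Fin n → ℝ)).toLinearMap h1
  exact h2.comp (Equiv.subtypeEquivRight fun i => mem_activeSet) (Equiv.injective _)

theorem IsStrictKKT.stationary_eq (h : IsStrictKKT f c y xs l)
    (hf : ContDiff ℝ 2 f) (hc : ∀ i, ContDiff ℝ 2 (c i)) (hy : f xs < f y) :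
    gradient f xs = ∑ i, ((f y - f xs) * l i) • gradient (c i) xs := by
  have h1 := h.stationary
  rw [gradient_lagrangian hf hc hy, sub_eq_zero] at h1
  simp only [mul_smul, ← Finset.smul_sum, ← h1]
  rw [smul_inv_smul₀ (sub_pos.2 hy).ne']

theorem IsStrictKKT.passive_eq (h : IsStrictKKT f c y xs l) {i : Fin m}
    (hi : i ∉ activeSet c xs) : l i = 0 :=
  (mul_eq_zero.1 (h.complementary i)).resolve_right fun h0 => hi (mem_activeSet.2 h0)

/-- The second order sufficient condition for the transformed problem gives the one for the
original problem, with multipliers scaled by `f y - f xs`. -/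
theorem SecondOrderSufficient.regularKKT (h : SecondOrderSufficient f c y xs l)
    (hf : ContDiff ℝ 2 f) (hc : ∀ i, ContDiff ℝ 2 (c i)) (hy : f xs < f y) :
    RegularKKT f c xs fun i => (f y - f xs) * l i := by
  have hσ : 0 < f y - f xs := sub_pos.2 hy
  refine ⟨h.kkt.feasible, h.kkt.stationary_eq hf hc hy, fun i hi => ?_, fun i hi => ?_,
    fun u hu hA => ?_, linearIndependent_of_full_rank h.full_rank⟩
  · rw [h.kkt.passive_eq hi, mul_zero]
  · exact mul_pos hσ (h.kkt.active_pos i (mem_activeSet.1 hi))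
  · obtain ⟨μ, hμ, hcurv⟩ := h.curvature
    have h1 := hcurv u (by
      ext i
      rw [activeJacobian_mulVec]
      exact hA i.1 (mem_activeSet.2 i.2))
    -- By stationarity ∇f(xs) is a combination of active gradients. The rank-one term that the
    -- logarithm adds to the Hessian therefore vanishes on the kernel.
    have h2 : inner ℝ (gradient f xs) u = 0 := by
      rw [h.kkt.stationary_eq hf hc hy, sum_inner]
      refine Finset.sum_eq_zero fun i _ => ?_
      by_cases hi : i ∈ activeSet c xs
      · rw [inner_smul_left, hA i hi, mul_zero]
      · rw [h.kkt.passive_eq hi, mul_zero, zero_smul, inner_zero_left]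
    rw [hessian_lagrangian_inner hf hc hy, h2, real_inner_self_eq_norm_sq] at h1
    have h3 : 0 < μ * ‖u‖ ^ 2 := mul_pos hμ (pow_pos (norm_pos_iff.2 hu) 2)
    have h4 : inner ℝ (hessian f xs u) u
        - ∑ i, (f y - f xs) * l i * inner ℝ (hessian (c i) xs u) u
        = (f y - f xs) * ((f y - f xs)⁻¹ * inner ℝ (hessian f xs u) u
          - ∑ i, l i * inner ℝ (hessian (c i) xs u) u) := by
      rw [mul_sub, Finset.mul_sum, mul_inv_cancel_left₀ hσ.ne']
      simp only [mul_assoc]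
    rw [h4]
    refine mul_pos hσ (h3.trans_le (h1.trans_eq ?_))
    ring

/-- The multipliers of the transformed problems with different centers are proportional. -/
theorem RegularKKT.multiplier_eq {ν : Fin m → ℝ} (hreg : RegularKKT f c xs ν)
    (h : IsStrictKKT f c y xs l)
    (hf : ContDiff ℝ 2 f) (hc : ∀ i, ContDiff ℝ 2 (c i)) (hy : f xs < f y) (i : Fin m) :
    l i = (f y - f xs)⁻¹ * ν i := by
  have hσ : f y - f xs ≠ 0 := (sub_pos.2 hy).ne'
  by_cases hi : i ∈ activeSet c xs
  · have h1 : ∑ j, ((f y - f xs) * l j - ν j) • gradient (c j) xs = 0 := by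
      simp only [sub_smul, Finset.sum_sub_distrib]
      rw [← h.stationary_eq hf hc hy, ← hreg.stationary, sub_self]
    have h2 : ∑ j : {j // j ∈ activeSet c xs},
        ((f y - f xs) * l j.1 - ν j.1) • gradient (c j.1) xs = 0 := by
      rw [Finset.sum_coe_sort (activeSet c xs)
        fun j => ((f y - f xs) * l j - ν j) • gradient (c j) xs, ← h1]
      refine Finset.sum_subset (Finset.subset_univ _) fun j _ hj => ?_
      rw [h.passive_eq hj, hreg.passive_eq j hj]
      simp
    have h3 := Fintype.linearIndependent_iff.1 hreg.independent
      (fun j => (f y - f xs) * l j.1 - ν j.1) h2 ⟨i, hi⟩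
    rw [← sub_eq_zero.1 h3, inv_mul_cancel_left₀ hσ]
  · rw [h.passive_eq hi, hreg.passive_eq i hi, mul_zero]

theorem mem_edfDomain_of_feasible {k : ℝ} (hk : 0 < k) (hxs : xs ∈ feasibleSet c)
    (hy : f xs < f y) : xs ∈ edfDomain f c y k :=
  ⟨hy, fun i => by have := mul_nonneg hk.le (hxs i); linarith⟩

end Regularity

end ExteriorDistance

end

noncomputable section

namespace ExteriorDistance

open Set Filter Topology

/-! ### All conclusions for one center. -/

section Convergence

variable {n m : ℕ} {f : EuclideanSpace ℝ (Fin n) → ℝ}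
  {c : Fin m → EuclideanSpace ℝ (Fin n) → ℝ}
  {xs y : EuclideanSpace ℝ (Fin n)} {ν ls : Fin m → ℝ}
  {r κ γ B α K νm τ₀ δ k₀ : ℝ}

/-- Minimizer, error bound and local strong convexity for a fixed center. -/
theorem LocalEstimates.exists_minimizer_map
    (H : LocalEstimates f c xs ν r κ γ B α K νm) (hreg : RegularKKT f c xs ν)
    (hf : ContDiff ℝ 2 f) (hc : ∀ i, ContDiff ℝ 2 (c i))
    (hfconv : ConvexOn ℝ univ f) (hcconc : ∀ i, ConcaveOn ℝ univ (c i))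
    (hD : DualThresholds m r κ γ B α νm τ₀ δ k₀) (hτ₀ : 0 < τ₀)
    (hy : f xs < f y) (hτ : τ₀ ≤ (f y - f xs)⁻¹)
    (hls : ∀ i, ls i = (f y - f xs)⁻¹ * ν i) :
    ∃ C : ℝ, 0 < C ∧ ∃ xhat : (Fin m → ℝ) → ℝ → EuclideanSpace ℝ (Fin n),
      ∀ (l : Fin m → ℝ) (k : ℝ), (l, k) ∈ dualNeighborhood c xs ls δ k₀ →
        IsEDFMinimizer f c y l k (xhat l k) ∧
        (∀ x, IsEDFMinimizer f c y l k x → x = xhat l k) ∧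
        gradient (edf f c y l k) (xhat l k) = 0 ∧
        max ‖(xhat l k - xs).ofLp‖ ‖multiplierUpdate c l k (xhat l k) - ls‖
          ≤ C * k⁻¹ * ‖l - ls‖ ∧
        ∃ ε : ℝ, 0 < ε ∧ Metric.ball (xhat l k) ε ⊆ edfDomain f c y k ∧
          ∃ ρ : ℝ, 0 < ρ ∧ StrongConvexOn (Metric.ball (xhat l k) ε) ρ (edf f c y l k) := by
  obtain ⟨C, hC, hbound⟩ := H.exists_error_bound hreg hf hc hfconv hcconc hD hy hτ
  refine ⟨C, hC, ?_⟩
  suffices h : ∀ (l : Fin m → ℝ) (k : ℝ), ∃ z : EuclideanSpace ℝ (Fin n),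
      (l, k) ∈ dualNeighborhood c xs ls δ k₀ →
        IsEDFMinimizer f c y l k z ∧ (∀ x, IsEDFMinimizer f c y l k x → x = z) ∧
        gradient (edf f c y l k) z = 0 ∧
        max ‖(z - xs).ofLp‖ ‖multiplierUpdate c l k z - ls‖ ≤ C * k⁻¹ * ‖l - ls‖ ∧
        ∃ ε : ℝ, 0 < ε ∧ Metric.ball z ε ⊆ edfDomain f c y k ∧
          ∃ ρ : ℝ, 0 < ρ ∧ StrongConvexOn (Metric.ball z ε) ρ (edf f c y l k) by
    choose xhat hxhat using h
    exact ⟨xhat, hxhat⟩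
  intro l k
  by_cases hmem : (l, k) ∈ dualNeighborhood c xs ls δ k₀
  swap
  -- Outside the dual neighborhood `xhat` takes the arbitrary value `xs`.
  · exact ⟨xs, fun h => absurd h hmem⟩
  obtain ⟨hk₀, hact, hpass⟩ := hmem
  simp only at hk₀ hact hpass
  have hk : 0 < k := hD.k₀_pos.trans_le hk₀
  have hl : ∀ i, 0 ≤ l i := fun i => by
    by_cases hi : c i xs = 0
    · exact hD.δ_pos.le.trans (hact i hi).1
    · exact (hpass i hi).1
  have hlact : ∀ i ∈ activeSet c xs, 0 < l i := fun i hi =>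
    hD.δ_pos.trans_le (hact i (mem_activeSet.1 hi)).1
  have hδ : ∀ i, |l i - (f y - f xs)⁻¹ * ν i| ≤ δ * k := fun i => by
    by_cases hi : i ∈ activeSet c xs
    · rw [← hls]
      exact (hact i (mem_activeSet.1 hi)).2
    · rw [hreg.passive_eq i hi, mul_zero, sub_zero, abs_of_nonneg (hl i)]
      exact (hpass i fun h0 => hi (mem_activeSet.2 h0)).2
  have hxsD : xs ∈ edfDomain f c y k := mem_edfDomain_of_feasible hk hreg.feasible hy
  obtain ⟨z, hzr, hzmin, hzcrit⟩ := exists_isEDFMinimizer_of_radial hf hc hfconv hcconc hk hl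
    H.r_pos hxsD
    (fun i hi x hx => H.γ_pos.le.trans (H.passive x hx i fun hia => (hlact i hia).ne' hi))
    (fun x hx hxD => H.radial_pos hreg hf hc hfconv hcconc hD hτ₀ hy hτ hk₀ hl hδ hxD hx)
  obtain ⟨ε, hε, hsub, ρ, hρ, hstrong⟩ :=
    H.exists_strongConvexOn_edf hreg hf hc hfconv hcconc hk hl hlact hzmin.1 hzr
  -- The error bound is linear in T, and T = ‖l - ls‖/k produces the factor 1/k.
  have hT0 : 0 ≤ k⁻¹ * ‖l - ls‖ := mul_nonneg (inv_pos.2 hk).le (norm_nonneg _)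
  have hT : ∀ i, |l i - (f y - f xs)⁻¹ * ν i| ≤ k⁻¹ * ‖l - ls‖ * k := fun i => by
    rw [← hls, mul_comm, mul_inv_cancel_left₀ hk.ne']
    exact norm_le_pi_norm (l - ls) i
  obtain ⟨hprim, hdual⟩ := hbound l k _ z hk₀ hl hδ hT0 hT hzmin.1 hzr hzcrit
  rw [← mul_assoc] at hprim hdual
  have hrhs : 0 ≤ C * k⁻¹ * ‖l - ls‖ := by rw [mul_assoc]; exact mul_nonneg hC.le hT0
  refine ⟨z, fun _ => ⟨hzmin, fun x hx => ?_, hzcrit, max_le ?_ ?_, ε, hε, hsub, ρ, hρ, hstrong⟩⟩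
  · exact eq_of_isMinOn_of_strongConvexOn (convexOn_edf hfconv hcconc hk hl) hzmin.1 hx.1
      hzmin.2 hx.2 hε hρ hsub hstrong
  · refine (pi_norm_le_iff_of_nonneg hrhs).2 fun i => ?_
    exact (PiLp.norm_apply_le (z - xs) i).trans hprim
  · refine (pi_norm_le_iff_of_nonneg hrhs).2 fun i => ?_
    rw [Pi.sub_apply, hls]
    exact hdual i

end Convergence

end ExteriorDistance

end

/-! ### Assembly, uniform over centers of level at most M. -/

theorem mainTheorem2 {n m : ℕ}
    (f : EuclideanSpace ℝ (Fin n) → ℝ) (c : Fin m → EuclideanSpace ℝ (Fin n) → ℝ)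
    (hf : ContDiff ℝ 2 f) (hc : ∀ i, ContDiff ℝ 2 (c i))
    (hfconv : ConvexOn ℝ Set.univ f) (hcconc : ∀ i, ConcaveOn ℝ Set.univ (c i))
    (xs : EuclideanSpace ℝ (Fin n))
    (hxs : xs ∈ ExteriorDistance.feasibleSet c)
    (hmin : IsMinOn f (ExteriorDistance.feasibleSet c) xs)
    -- `ls y` is the multiplier vector of the transformed problem with center `y`
    (ls : EuclideanSpace ℝ (Fin n) → Fin m → ℝ)
    (hsosc : ∀ y ∈ interior (ExteriorDistance.feasibleSet c), f xs < f y →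
      ExteriorDistance.SecondOrderSufficient f c y xs (ls y))
    (M : ℝ) :
    ∃ δ : ℝ, 0 < δ ∧ ∃ k₀ : ℝ, 0 < k₀ ∧
      ∀ y ∈ interior (ExteriorDistance.feasibleSet c), f xs < f y → f y ≤ M →
        (∀ i, c i xs = 0 → δ < ls y i) ∧
        ∃ C : ℝ, 0 < C ∧ ∃ xhat : (Fin m → ℝ) → ℝ → EuclideanSpace ℝ (Fin n),
          (∀ (l : Fin m → ℝ) (k : ℝ),
            (l, k) ∈ ExteriorDistance.dualNeighborhood c xs (ls y) δ k₀ →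
            -- existence and uniqueness of the minimizer
            ExteriorDistance.IsEDFMinimizer f c y l k (xhat l k) ∧
            (∀ x, ExteriorDistance.IsEDFMinimizer f c y l k x → x = xhat l k) ∧
            gradient (ExteriorDistance.edf f c y l k) (xhat l k) = 0 ∧
            -- the error bound, in the maximum norms of `ℝⁿ` and `ℝᵐ`
            max ‖(xhat l k - xs).ofLp‖
                ‖ExteriorDistance.multiplierUpdate c l k (xhat l k) - ls y‖
              ≤ C * k⁻¹ * ‖l - ls y‖ ∧
            -- strong convexity near the minimizer
            ∃ ε : ℝ, 0 < ε ∧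
              Metric.ball (xhat l k) ε ⊆ ExteriorDistance.edfDomain f c y k ∧
              ∃ ρ : ℝ, 0 < ρ ∧
                StrongConvexOn (Metric.ball (xhat l k) ε) ρ
                  (ExteriorDistance.edf f c y l k)) ∧
          -- the fixed point property
          (∀ k : ℝ, k₀ ≤ k →
            xhat (ls y) k = xs ∧
            ExteriorDistance.multiplierUpdate c (ls y) k (xhat (ls y) k) = ls y) := by
  -- One center y₀ supplies ν and all local constants for every other center. Without any center the
  -- claim is vacuous.
  by_cases hcenter : ∃ y ∈ interior (ExteriorDistance.feasibleSet c), f xs < f y ∧ f y ≤ M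
  swap
  · exact ⟨1, one_pos, 1, one_pos, fun y hy hlt hM => absurd ⟨y, hy, hlt, hM⟩ hcenter⟩
  obtain ⟨y₀, hy₀, hlt₀, hM₀⟩ := hcenter
  have hreg := (hsosc y₀ hy₀ hlt₀).regularKKT hf hc hlt₀
  obtain ⟨r, κ, γ, B, α, K, νm, H⟩ := hreg.exists_localEstimates hf hc hfconv hcconc
  have hτ₀ : 0 < (M - f xs)⁻¹ := inv_pos.2 (by linarith)
  obtain ⟨δ, k₀, hD⟩ := ExteriorDistance.exists_dualThresholds (B := B) (γ := γ) (α := α) m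
    H.r_pos H.κ_pos H.νm_pos hτ₀
  refine ⟨δ, hD.δ_pos, k₀, hD.k₀_pos, fun y hy hlt hM => ?_⟩
  have hσ : 0 < f y - f xs := sub_pos.2 hlt
  have hτ : (M - f xs)⁻¹ ≤ (f y - f xs)⁻¹ := inv_anti₀ hσ (by linarith)
  have hkkt := (hsosc y hy hlt).kkt
  have hls := hreg.multiplier_eq hkkt hf hc hlt
  have hδls : ∀ i, c i xs = 0 → δ < ls y i := fun i hi => by
    rw [hls]
    exact hD.lt_multiplier.trans_le (mul_le_mul hτ
      (H.le_multiplier i (ExteriorDistance.mem_activeSet.2 hi)) H.νm_pos.le (inv_pos.2 hσ).le)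
  refine ⟨hδls, ?_⟩
  obtain ⟨C, hC, xhat, hxhat⟩ :=
    H.exists_minimizer_map hreg hf hc hfconv hcconc hD hτ₀ hlt hτ hls
  refine ⟨C, hC, xhat, hxhat, fun k hk => ?_⟩
  have hδk : 0 ≤ δ * k := mul_nonneg hD.δ_pos.le (hD.k₀_pos.le.trans hk)
  have hmem : (ls y, k) ∈ ExteriorDistance.dualNeighborhood c xs (ls y) δ k₀ := by
    refine ⟨hk, fun i hi => ⟨(hδls i hi).le, by simpa using hδk⟩, fun i hi => ?_⟩
    have h0 : ls y i = 0 := hkkt.passive_eq fun h => hi (ExteriorDistance.mem_activeSet.1 h)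
    simp only [h0]
    exact ⟨le_rfl, hδk⟩
  -- At l = `ls y` the right-hand side of the error bound is zero, so both errors vanish.
  have hbound := (hxhat (ls y) k hmem).2.2.2.1
  rw [sub_self, norm_zero, mul_zero] at hbound
  constructor
  · have h1 := norm_le_zero_iff.1 ((le_max_left _ _).trans hbound)
    exact sub_eq_zero.1 ((WithLp.ofLp_eq_zero 2).1 h1)
  · exact sub_eq_zero.1 (norm_le_zero_iff.1 ((le_max_right _ _).trans hbound))
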